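/- For a permutation $\sigma$ of $[n]=\{1,\dots,n\}$ let $\mathrm{inv}(\sigma)$ be the number of pairs $i<j$ with $\sigma(i)>\sigma(j)$. For $q\in(0,1]$, a random permutation $\tau_n$ of $[n]$ has the Mallows$(n,q)$ distribution if $\mathbb P(\tau_n=\sigma)=q^{\mathrm{inv}(\sigma)}/Z_{n,q}$ for all $\sigma\in\mathfrak S_n$, where $Z_{n,q}=\prod_{k=1}^n(1+q+\dots+q^{k-1})$; for $q=1$ this is the uniform distribution. For $\pi\in\mathfrak S_r$ and $\tau\in\mathfrak S_n$, let $\mathrm{occ}_\pi(\tau)$ be the number of subsets $\{i_1<\dots<i_r\}\subseteq[n]$ such that, for all $j,k\in[r]$, $\pi(j)<\pi(k)$ if and only if $\tau(i_j)<\tau(i_k)$. For $\pi\in\mathfrak S_r$ and $x,y\in[0,1]$ let $$\varphi_\pi(x,y)=\frac1{(r-1)!}\sum_{k=1}^r\binom{r-1}{k-1}x^{k-1}(1-x)^{r-k}\binom{r-1}{\pi(k)-1}y^{\pi(k)-1}(1-y)^{r-\pi(k)},$$ the probability that $(x,y)$ and $r-1$ independent uniform points of $[0,1]^2$ form the pattern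 $\pi$, and for $\pi\in\mathfrak S_r$, $\rho\in\mathfrak S_s$ let $$\Sigma_{\pi,\rho}=\frac1{(r-1)!\,(s-1)!}\int_0^1\!\!\int_0^1\Bigl(\varphi_\pi(x,y)-\frac1{r!}\Bigr)\Bigl(\varphi_\rho(x,y)-\frac1{s!}\Bigr)\,dy\,dx .$$ **Theorem.** Let $q_n\in(0,1]$ satisfy $n^{3/2}(1-q_n)\to0$ as $n\to\infty$, and for each $n$ let $\tau_n$ have the Mallows$(n,q_n)$ distribution. Let $\pi_1\in\mathfrak S_{r_1},\dots,\pi_m\in\mathfrak S_{r_m}$ be finitely many patterns of sizes $r_i\ge2$. Then $\nu_{\pi_i}^2:=\Sigma_{\pi_i,\pi_i}>0$ for each $i$, the matrix $(\Sigma_{\pi_i,\pi_j})_{i,j}$ is positive semidefinite, and as $n\to\infty$, in distribution, $$\frac{\mathrm{occ}_{\pi_i}(\tau_n)-\frac1{r_i!}\binom n{r_i}}{n^{r_i-1/2}}\longrightarrow\mathcal N(0,\nu_{\pi_i}^2)\quad\text{for each }i,$$ and jointly $$\left(\frac{\mathrm{occ}_{\pi_i}(\tau_n)-\frac1{r_i!}\binom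 n{r_i}}{n^{r_i-1/2}}\right)_{1\le i\le m}\longrightarrow\mathcal N\bigl(0,(\Sigma_{\pi_i,\pi_j})_{1\le i,j\le m}\bigr).$$ The same joint convergence, with the same limit, holds when $\tau_n$ is replaced by a uniformly random permutation $u_n$ of $[n]$. -/

import Mathlib

open MeasureTheory ProbabilityTheory Filter Topology

/-- The number of inversions of `σ`: pairs `i < j` with `σ i > σ j`. -/
def invCount {n : ℕ} (σ : Equiv.Perm (Fin n)) : ℕ :=
  (Finset.univ.filter fun p : Fin n × Fin n => p.1 < p.2 ∧ σ p.2 < σ p.1).card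

/-- The normalizing constant `Z_{n,q} = ∏_{k=1}^n (1 - q^k) / (1 - q)`, each factor being written as
`1 + q + ⋯ + q^(k-1)`, so that it is also correct (and equal to `k`) at `q = 1`. -/
noncomputable def mallowsZ (n : ℕ) (q : ℝ) : ℝ :=
  ∏ k ∈ Finset.Icc 1 n, ∑ j ∈ Finset.range k, q ^ j

/-- `τ` is a random permutation of `n` elements with the Mallows distribution of parameter `q`. -/
structure IsMallows {Ω : Type*} [MeasurableSpace Ω] (P : Measure Ω) {n : ℕ} (q : ℝ)
    (τ : Ω → Equiv.Perm (Fin n)) : Prop where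
  measurable : ∀ σ, MeasurableSet (τ ⁻¹' {σ})
  prob_eq : ∀ σ, P.real (τ ⁻¹' {σ}) = q ^ invCount σ / mallowsZ n q

/-- `u` is a uniformly random permutation of `n` elements. -/
structure IsUniformPerm {Ω : Type*} [MeasurableSpace Ω] (P : Measure Ω) {n : ℕ}
    (u : Ω → Equiv.Perm (Fin n)) : Prop where
  measurable : ∀ σ, MeasurableSet (u ⁻¹' {σ})
  prob_eq : ∀ σ, P.real (u ⁻¹' {σ}) = 1 / (n.factorial : ℝ)

/-- The pattern induced by `τ` on `I = {i_0 < ⋯ < i_{r-1}}` is `π`: `I` has `r` elements, and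
`π j < π k ↔ τ i_j < τ i_k` for all `j, k`. -/
def IsOccurrence {r n : ℕ} (π : Equiv.Perm (Fin r)) (τ : Equiv.Perm (Fin n))
    (I : Finset (Fin n)) : Prop :=
  ∃ h : I.card = r, ∀ j k : Fin r,
    π j < π k ↔ τ (I.orderEmbOfFin h j) < τ (I.orderEmbOfFin h k)

open Classical in
/-- The number of classical occurrences of the pattern `π` in `τ`. -/
noncomputable def occ {r n : ℕ} (π : Equiv.Perm (Fin r)) (τ : Equiv.Perm (Fin n)) : ℕ :=
  (Finset.univ.filter fun I : Finset (Fin n) => IsOccurrence π τ I).card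

/-- `(occ_π(τ) - C(n,r) / r!) / n^{r - 1/2}`. -/
noncomputable def normalizedOcc {r n : ℕ} (π : Equiv.Perm (Fin r)) (τ : Equiv.Perm (Fin n)) : ℝ :=
  ((occ π τ : ℝ) - (n.choose r : ℝ) / (r.factorial : ℝ)) / (n : ℝ) ^ ((r : ℝ) - 1 / 2)

/-- The normalized counts of finitely many patterns, as a random vector. -/
noncomputable def occVector {m n : ℕ} {r : Fin m → ℕ} (π : ∀ i, Equiv.Perm (Fin (r i)))
    (τ : Equiv.Perm (Fin n)) : EuclideanSpace ℝ (Fin m) :=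
  WithLp.toLp 2 fun i => normalizedOcc (π i) τ

/-- The probability that exactly `k` of `r - 1` independent uniform points of `[0,1]` are less
than `x`. -/
noncomputable def bernsteinProb (r : ℕ) (k : Fin r) (x : ℝ) : ℝ :=
  ((r - 1).choose k : ℝ) * x ^ (k : ℕ) * (1 - x) ^ (r - 1 - (k : ℕ))

/-- The probability that the point `(x, y)` and `r - 1` independent uniform points of `[0,1]²`
form the pattern `π`: if `(x, y)` is the point of index `k` from the left then its height must have
rank `π k`, and the other `r - 1` points must form the pattern left when `k` is deleted. -/
noncomputable def patternProj {r : ℕ} (π : Equiv.Perm (Fin r)) (x y : ℝ) : ℝ :=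
  (1 / ((r - 1).factorial : ℝ)) * ∑ k, bernsteinProb r k x * bernsteinProb r (π k) y

/-- The asymptotic covariance of the normalized counts of `π` and `ρ` in a uniform permutation:
`Cov(patternProj π (X, Y), patternProj ρ (X, Y)) / ((r-1)! (s-1)!)` with `(X, Y)` uniform
on `[0,1]²`. -/
noncomputable def patternCov {r s : ℕ} (π : Equiv.Perm (Fin r)) (ρ : Equiv.Perm (Fin s)) : ℝ :=
  (∫ x in (0 : ℝ)..1, ∫ y in (0 : ℝ)..1,
      (patternProj π x y - 1 / (r.factorial : ℝ)) * (patternProj ρ x y - 1 / (s.factorial : ℝ))) /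
    (((r - 1).factorial : ℝ) * ((s - 1).factorial : ℝ))

/-- The asymptotic covariance matrix of a finite family of patterns. -/
noncomputable def patternCovMatrix {m : ℕ} {r : Fin m → ℕ} (π : ∀ i, Equiv.Perm (Fin (r i))) :
    Matrix (Fin m) (Fin m) ℝ :=
  Matrix.of fun i j => patternCov (π i) (π j)

/-! The Mallows laws are compared with the uniform law in total variation, so everything reduces to
uniform permutations.

In the uniform case, sample n i.i.d. uniform points of the square; their relative order is a uniform
permutation (`isUniformPerm_inducedPerm`), and its pattern counts are U-statistics with kernel
`patternKernel`. Hoeffding's projection (`exists_hoeffding_projection_bound`) replaces each count by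
n^(r-1) times an i.i.d. sum of `centeredProj`, with mean square error O(n^(2r-2)), against the scale
n^(2r-1) of the squared normalization. The projection is explicit: one point of a pattern has a
Bernstein density in each coordinate, and the two coordinates are independent. The classical central
limit theorem for linear combinations then gives the uniform limit. The covariance matrix is a Gram
matrix in L² of the square, hence positive semidefinite. The variances are positive because the
projection is continuous and nonzero at the corner (0,0).

For the comparison, put q = exp(-l) and N = n^(3/2). Under the uniform law inv = C(n,2)/2 + N W,
where W is the normalized count of the pattern 21 and is bounded in L². Pairing opposite terms of
each geometric sum gives Z ≤ n! exp(-l C(n,2)/2 + l² n³/2). Hence the Mallows-to-uniform density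
ratio is at least exp(-l N W - (l N)²/2), and the L¹ distance is O(l N + (l N)²), which vanishes
exactly in the assumed regime (`exists_sum_abs_mallows_sub_le`). Characteristic functions differ by
at most the L¹ distance, so the limit transfers. -/

section Resampling

/-! ### Hoeffding's projection for bounded U-statistics. -/

variable {E : Type*} [MeasurableSpace E] (μ : Measure E) [IsProbabilityMeasure μ]

/-- Replacing the coordinates in `S` by those of an independent copy preserves a product measure. -/
lemma measurePreserving_resample {ι : Type*} (S : Set ι) [DecidablePred (· ∈ S)] :
    MeasurePreserving (fun p : (ι → E) × (ι → E) => fun i => if i ∈ S then p.2 i else p.1 i)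
      ((Measure.infinitePi fun _ : ι => μ).prod (Measure.infinitePi fun _ : ι => μ))
      (Measure.infinitePi fun _ : ι => μ) := by
  have hm : Measurable
      (fun p : (ι → E) × (ι → E) => fun i => if i ∈ S then p.2 i else p.1 i) := by
    refine measurable_pi_lambda _ fun i => ?_
    split_ifs <;> fun_prop
  refine ⟨hm, Measure.eq_infinitePi (fun _ : ι => μ) fun s t ht => ?_⟩
  rw [Measure.map_apply hm (.pi s.countable_toSet fun i _ => ht i)]
  have hpre : (fun p : (ι → E) × (ι → E) => fun i => if i ∈ S then p.2 i else p.1 i) ⁻¹'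
      (Set.pi s t) = Set.pi (s.filter (· ∉ S) : Finset ι) t ×ˢ
        Set.pi (s.filter (· ∈ S) : Finset ι) t := by
    ext p
    simp only [Set.mem_preimage, Set.mem_pi, Finset.mem_coe, Set.mem_prod, Finset.mem_filter]
    constructor
    · exact fun h => ⟨fun i hi => by simpa [hi.2] using h i hi.1,
        fun i hi => by simpa [hi.2] using h i hi.1⟩
    · intro h i hi
      by_cases hS : i ∈ S
      · simpa [hS] using h.2 i ⟨hi, hS⟩
      · simpa [hS] using h.1 i ⟨hi, hS⟩
  rw [hpre, Measure.prod_prod, Measure.infinitePi_pi _ fun i _ => ht i,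
    Measure.infinitePi_pi _ fun i _ => ht i, mul_comm]
  exact Finset.prod_filter_mul_prod_filter_not s (· ∈ S) _

/-- Distinct coordinates of an i.i.d. sequence are distributed as a finite product measure. -/
lemma measurePreserving_comp_injective {ι κ : Type*} [Fintype κ] {f : κ → ι}
    (hf : Function.Injective f) :
    MeasurePreserving (fun (ω : ι → E) k => ω (f k))
      (Measure.infinitePi fun _ : ι => μ) (Measure.pi fun _ : κ => μ) := by
  have hm : Measurable (fun (ω : ι → E) (k : κ) => ω (f k)) := by fun_prop
  refine ⟨hm, (Measure.pi_eq fun t ht => ?_).symm⟩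
  classical
  rw [Measure.map_apply hm (.univ_pi ht)]
  have hpre : (fun (ω : ι → E) (k : κ) => ω (f k)) ⁻¹' (Set.univ.pi t) =
      Set.pi (Finset.univ.map ⟨f, hf⟩ : Finset ι) (Function.extend f t fun _ => Set.univ) := by
    ext ω
    simp [hf.extend_apply]
  rw [hpre, Measure.infinitePi_pi]
  · simp [hf.extend_apply]
  · intro i hi
    obtain ⟨k, -, rfl⟩ := Finset.mem_map.1 hi
    simpa [hf.extend_apply] using ht k

/-- The mean of `H` over all arguments but the `j`-th, which is fixed. -/
noncomputable def slotMean {ι : Type*} [Fintype ι] [DecidableEq ι] (H : (ι → E) → ℝ) (j : ι)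
    (z : E) : ℝ :=
  ∫ w, H (Function.update w j z) ∂Measure.pi fun _ : ι => μ

variable {ι : Type*} [Fintype ι] [DecidableEq ι]

omit [Fintype ι] in
lemma measurable_update_pair (j : ι) :
    Measurable fun p : E × (ι → E) => Function.update p.2 j p.1 := by
  refine measurable_pi_lambda _ fun i => ?_
  rcases eq_or_ne i j with rfl | h
  · simpa using measurable_fst
  · simp only [Function.update_of_ne h]; fun_prop

lemma measurable_slotMean {H : (ι → E) → ℝ} (hH : Measurable H) (j : ι) :
    Measurable (slotMean μ H j) := by
  have : StronglyMeasurable fun p : E × (ι → E) => H (Function.update p.2 j p.1) :=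
    (hH.comp (measurable_update_pair j)).stronglyMeasurable
  exact this.integral_prod_right.measurable

lemma abs_slotMean_le {H : (ι → E) → ℝ} {B : ℝ} (hB : ∀ w, |H w| ≤ B) (j : ι) (z : E) :
    |slotMean μ H j z| ≤ B := by
  simpa [slotMean] using norm_integral_le_of_norm_le_const (μ := Measure.pi fun _ : ι => μ)
    (f := fun w => H (Function.update w j z)) (C := B) (Eventually.of_forall fun w => hB _)

lemma integrable_of_abs_le {α : Type*} [MeasurableSpace α] {ν : Measure α} [IsFiniteMeasure ν]
    {F : α → ℝ} (hF : Measurable F) {B : ℝ} (hB : ∀ w, |F w| ≤ B) : Integrable F ν :=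
  .of_bound hF.aestronglyMeasurable B (Eventually.of_forall hB)

/-- Resampling every coordinate except the `j`-th leaves the product law unchanged, which is Fubini
for a single slot without splitting the product space. -/
lemma integral_slotMean {H : (ι → E) → ℝ} (hH : Measurable H) {B : ℝ} (hB : ∀ w, |H w| ≤ B)
    (j : ι) : ∫ z, slotMean μ H j z ∂μ = ∫ w, H w ∂Measure.pi fun _ : ι => μ := by
  have h := measurePreserving_resample μ {i : ι | i ≠ j}
  simp only [Measure.infinitePi_eq_pi] at h
  rw [← h.map_eq, integral_map h.measurable.aemeasurable hH.aestronglyMeasurable,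
    integral_prod _ (integrable_of_abs_le (by exact hH.comp h.measurable) fun p => hB _)]
  have he := measurePreserving_eval (fun _ : ι => μ) j
  have hj := integral_map (μ := Measure.pi fun _ : ι => μ) (f := slotMean μ H j)
    he.measurable.aemeasurable (measurable_slotMean μ hH j).aestronglyMeasurable
  rw [he.map_eq] at hj
  rw [hj]
  refine integral_congr_ae (Eventually.of_forall fun v => ?_)
  refine integral_congr_ae (Eventually.of_forall fun w => ?_)
  refine congrArg H (funext fun i => ?_)
  by_cases hi : i = j
  · subst hi; simp
  · simp [hi]

/-- Summands of a completely degenerate statistic that share at most one variable are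
orthogonal. -/
lemma integral_mul_comp_eq_zero {D : (ι → E) → ℝ} (hD : Measurable D) {B : ℝ}
    (hB : ∀ w, |D w| ≤ B) (h0 : ∀ a z, slotMean μ D a z = 0) {κ : Type*} {f f' : ι → κ}
    (hf : Function.Injective f) (a : ι) (ha : ∀ a' b, f a' = f' b → a' = a) :
    ∫ ω, D (fun i => ω (f i)) * D (fun i => ω (f' i)) ∂Measure.infinitePi (fun _ : κ => μ) = 0 := by
  classical
  -- Resample every variable of the first factor except `f a`. By `ha` the second factor uses none
  -- of these, so it is constant in the new copy, and the first factor averages to a `slotMean` of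
  -- `D`, which is zero.
  have h := measurePreserving_resample μ {k : κ | ∃ i, i ≠ a ∧ f i = k}
  have hm (g : ι → κ) : Measurable fun ω : κ → E => D fun i => ω (g i) := by fun_prop
  have hint : Measurable fun ω : κ → E => D (fun i => ω (f i)) * D (fun i => ω (f' i)) :=
    (hm f).mul (hm f')
  rw [← h.map_eq, integral_map h.measurable.aemeasurable hint.aestronglyMeasurable,
    integral_prod _ (integrable_of_abs_le (B := B * B) (by exact hint.comp h.measurable) fun p => by
      rw [abs_mul]
      exact mul_le_mul (hB _) (hB _) (abs_nonneg _) ((abs_nonneg _).trans (hB fun i => p.1 (f i))))]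
  refine integral_eq_zero_of_ae (Eventually.of_forall fun ω => ?_)
  have key (ω' : κ → E) :
      D (fun i => if f i ∈ {k : κ | ∃ i, i ≠ a ∧ f i = k} then ω' (f i) else ω (f i)) *
        D (fun i => if f' i ∈ {k : κ | ∃ i, i ≠ a ∧ f i = k} then ω' (f' i) else ω (f' i)) =
      D (Function.update (fun i => ω' (f i)) a (ω (f a))) * D (fun i => ω (f' i)) := by
    congr 2
    · funext i
      rcases eq_or_ne i a with rfl | hi
      · simp [hf.eq_iff]
      · simp [hi, hf.eq_iff]
    · funext i
      refine if_neg ?_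
      rintro ⟨a', ha', h⟩
      exact ha' (ha a' i h)
  simp only [key, integral_mul_const, Pi.zero_apply]
  have hp := measurePreserving_comp_injective μ hf
  have hz := h0 a (ω (f a))
  rw [slotMean, ← hp.map_eq, integral_map hp.measurable.aemeasurable] at hz
  · rw [hz, zero_mul]
  · have : Measurable fun w : ι → E => Function.update w a (ω (f a)) :=
      (measurable_update_pair a).comp (measurable_const.prodMk measurable_id)
    exact (hD.comp this).aestronglyMeasurable

/-- Functions whose values on `S` are dictated by those off `S` are few. -/
lemma card_le_of_determined {n : ℕ} {κ : Type*} [Fintype κ] [DecidableEq κ] (S : Finset κ)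
    (p : κ → κ) (hp : ∀ s ∈ S, p s ∉ S) :
    (Finset.univ.filter fun g : κ → Fin n => ∀ s ∈ S, g s = g (p s)).card ≤
      n ^ (Fintype.card κ - S.card) := by
  have : Fintype.card ({k // k ∉ S} → Fin n) = n ^ (Fintype.card κ - S.card) := by
    simp [Fintype.card_subtype_compl]
  rw [← this, ← Finset.card_univ]
  refine Finset.card_le_card_of_injOn (fun g k => g k) (fun _ _ => Finset.mem_univ _) ?_
  intro g hg g' hg' h
  simp only [Finset.coe_filter, Finset.mem_univ, true_and, Set.mem_ofPred_eq] at hg hg'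
  have hoff (k : κ) (hk : k ∉ S) : g k = g' k := congrFun h ⟨k, hk⟩
  funext k
  by_cases hk : k ∈ S
  · rw [hg k hk, hg' k hk, hoff _ (hp k hk)]
  · exact hoff k hk

/-- Most functions are injective. -/
lemma card_not_injective_le (r n : ℕ) :
    (Finset.univ.filter fun f : Fin r → Fin n => ¬ Function.Injective f).card ≤
      r ^ 2 * n ^ (r - 1) := by
  classical
  have hsub : (Finset.univ.filter fun f : Fin r → Fin n => ¬ Function.Injective f) ⊆
      (Finset.univ : Finset (Fin r × Fin r)).biUnion fun c => Finset.univ.filter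
        fun f : Fin r → Fin n => c.1 ≠ c.2 ∧ f c.1 = f c.2 := by
    intro f hf
    obtain ⟨-, hf⟩ := Finset.mem_filter.1 hf
    obtain ⟨a, b, hab, hne⟩ := Function.not_injective_iff.1 hf
    simp only [Finset.mem_biUnion, Finset.mem_univ, true_and, Finset.mem_filter]
    exact ⟨(a, b), hne, hab⟩
  refine (Finset.card_le_card hsub).trans
    ((Finset.card_biUnion_le_card_mul _ _ (n ^ (r - 1)) ?_).trans (by simp [sq]))
  rintro ⟨a, b⟩ -
  by_cases hab : a = b
  · simp [hab]
  · have h := card_le_of_determined (n := n) {a} (fun _ => b) (by simpa using fun h => hab h.symm)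
    simpa [hab] using h

/-- Most pairs of functions have at most one common value. -/
lemma card_pairs_le {r : ℕ} (hr : 0 < r) (n : ℕ) :
    (Finset.univ.filter fun p : (Fin r → Fin n) × (Fin r → Fin n) =>
      Function.Injective p.1 ∧ ∀ a, ∃ a' b, p.1 a' = p.2 b ∧ a' ≠ a).card ≤
      r ^ 4 * n ^ (2 * r - 2) := by
  classical
  have hsub : (Finset.univ.filter fun p : (Fin r → Fin n) × (Fin r → Fin n) =>
      Function.Injective p.1 ∧ ∀ a, ∃ a' b, p.1 a' = p.2 b ∧ a' ≠ a) ⊆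
      (Finset.univ : Finset ((Fin r × Fin r) × Fin r × Fin r)).biUnion fun c => Finset.univ.filter
        fun p : (Fin r → Fin n) × (Fin r → Fin n) =>
          c.2.1 ≠ c.2.2 ∧ p.2 c.2.1 = p.1 c.1.1 ∧ p.2 c.2.2 = p.1 c.1.2 := by
    intro p hp
    obtain ⟨-, hinj, hp⟩ := Finset.mem_filter.1 hp
    -- The hypothesis at any index gives one coincidence; at `a₁` it gives a second with `a₂ ≠ a₁`.
    -- Injectivity of the first map forces `b₁ ≠ b₂`, so two of the 2r values are dictated by
    -- others.
    obtain ⟨a₁, b₁, h₁, -⟩ := hp ⟨0, hr⟩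
    obtain ⟨a₂, b₂, h₂, hne⟩ := hp a₁
    refine Finset.mem_biUnion.2 ⟨((a₁, a₂), (b₁, b₂)), Finset.mem_univ _, Finset.mem_filter.2
      ⟨Finset.mem_univ _, fun hb => hne (hinj ?_), h₁.symm, h₂.symm⟩⟩
    have hb : b₁ = b₂ := hb
    rw [h₁, h₂, hb]
  refine (Finset.card_le_card hsub).trans
    ((Finset.card_biUnion_le_card_mul _ _ (n ^ (2 * r - 2)) ?_).trans (le_of_eq ?_))
  · rintro ⟨⟨a₁, a₂⟩, b₁, b₂⟩ -
    by_cases hb : b₁ = b₂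
    · simp [hb]
    · have h := card_le_of_determined (n := n) (κ := Fin r ⊕ Fin r) {Sum.inr b₁, Sum.inr b₂}
        (Sum.elim Sum.inl fun b => Sum.inl (if b = b₁ then a₁ else a₂)) (by simp)
      rw [Finset.card_pair (by simpa using hb), Fintype.card_sum, Fintype.card_fin, ← two_mul] at h
      refine le_trans (Finset.card_le_card_of_injOn
        (Equiv.sumArrowEquivProdArrow (Fin r) (Fin r) (Fin n)).symm ?_
        (Equiv.injective _).injOn) h
      intro p hp
      simpa [hb, Ne.symm hb, Equiv.sumArrowEquivProdArrow] using (Finset.mem_filter.1 hp).2.2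
  · simp only [Finset.card_univ, Fintype.card_prod, Fintype.card_fin]
    ring

/-- The second moment of a completely degenerate statistic of `n` i.i.d. variables. -/
lemma integral_sq_sum_degenerate_le {r : ℕ} (hr : 0 < r) {D : (Fin r → E) → ℝ} (hD : Measurable D)
    {B : ℝ} (hB : ∀ w, |D w| ≤ B) (h0 : ∀ a z, slotMean μ D a z = 0) (n : ℕ) :
    ∫ ω, (∑ f : Fin r → Fin n with Function.Injective f, D fun i => ω (f i)) ^ 2
      ∂Measure.infinitePi (fun _ : ℕ => μ) ≤ B ^ 2 * r ^ 4 * (n : ℝ) ^ (2 * r - 2) := by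
  classical
  have hm (g : Fin r → Fin n) : Measurable fun ω : ℕ → E => D fun i => ω (g i) := by fun_prop
  have hBB (f f' : Fin r → Fin n) (ω : ℕ → E) :
      |D (fun i => ω (f i)) * D (fun i => ω (f' i))| ≤ B ^ 2 := by
    rw [abs_mul, sq]
    exact mul_le_mul (hB _) (hB _) (abs_nonneg _) ((abs_nonneg _).trans (hB fun i => ω (f i)))
  have hint (f f' : Fin r → Fin n) : Integrable
      (fun ω : ℕ → E => D (fun i => ω (f i)) * D (fun i => ω (f' i)))
      (Measure.infinitePi fun _ : ℕ => μ) :=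
    integrable_of_abs_le ((hm f).mul (hm f')) (hBB f f')
  simp only [sq (Finset.sum _ _), Finset.sum_mul_sum]
  rw [integral_finsetSum _ fun f _ => integrable_finsetSum _ fun f' _ => hint f f']
  simp only [integral_finsetSum _ fun f' _ => hint _ f']
  calc _ ≤ ∑ f : Fin r → Fin n with Function.Injective f,
        ∑ f' : Fin r → Fin n with Function.Injective f',
          if ∀ a, ∃ a' b, f a' = f' b ∧ a' ≠ a then B ^ 2 else 0 := by
        refine Finset.sum_le_sum fun f hf => Finset.sum_le_sum fun f' _ => ?_
        split_ifs with h
        · refine (le_abs_self _).trans ?_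
          simpa using norm_integral_le_of_norm_le_const
            (μ := Measure.infinitePi fun _ : ℕ => μ)
            (f := fun ω : ℕ → E => D (fun i => ω (f i)) * D (fun i => ω (f' i))) (C := B ^ 2)
            (Eventually.of_forall (hBB f f'))
        · push Not at h
          obtain ⟨a, ha⟩ := h
          refine (integral_mul_comp_eq_zero μ hD hB h0 (f := fun i => (f i : ℕ))
            (f' := fun i => (f' i : ℕ))
            (Fin.val_injective.comp (Finset.mem_filter.1 hf).2) a fun a' b hab => ?_).le
          exact ha a' b (Fin.ext hab)
    _ ≤ ∑ f : Fin r → Fin n with Function.Injective f, ∑ f' : Fin r → Fin n,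
          if ∀ a, ∃ a' b, f a' = f' b ∧ a' ≠ a then B ^ 2 else 0 := by
        refine Finset.sum_le_sum fun f _ => Finset.sum_le_sum_of_subset_of_nonneg
          (Finset.filter_subset _ _) fun _ _ _ => ?_
        split_ifs <;> positivity
    _ = ((Finset.univ.filter fun p : (Fin r → Fin n) × (Fin r → Fin n) =>
          Function.Injective p.1 ∧ ∀ a, ∃ a' b, p.1 a' = p.2 b ∧ a' ≠ a).card : ℝ) * B ^ 2 := by
        rw [← nsmul_eq_mul, ← Finset.sum_const, Finset.sum_filter, Finset.sum_filter,
          Fintype.sum_prod_type]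
        refine Finset.sum_congr rfl fun f _ => ?_
        split_ifs with h <;> simp [h]
    _ ≤ ((r ^ 4 * n ^ (2 * r - 2) : ℕ) : ℝ) * B ^ 2 := by
        gcongr
        exact card_pairs_le hr n
    _ = _ := by push_cast; ring

lemma sum_apply_eq {M : Type*} [AddCommMonoid M] (s n : ℕ) (j : Fin (s + 1)) (F : Fin n → M) :
    ∑ f : Fin (s + 1) → Fin n, F (f j) = n ^ s • ∑ k, F k := by
  rw [← (Fin.insertNthEquiv (fun _ => Fin n) j).sum_comp, Fintype.sum_prod_type,
    Finset.smul_sum]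
  simp [Fin.insertNthEquiv]

lemma card_injective (r n : ℕ) :
    (Finset.univ.filter fun f : Fin r → Fin n => Function.Injective f).card =
      n.descFactorial r := by
  classical
  rw [← Fintype.card_subtype, Fintype.card_congr (Equiv.subtypeInjectiveEquivEmbedding _ _),
    Fintype.card_embedding_eq, Fintype.card_fin, Fintype.card_fin]

/-- Hoeffding's projection: up to an error of smaller order in mean square, a `U`-statistic with
bounded kernel `H` is a sum of i.i.d. variables. -/
theorem exists_hoeffding_projection_bound {r : ℕ} (hr : 0 < r) {H : (Fin r → E) → ℝ}
    (hH : Measurable H) (hB : ∀ w, |H w| ≤ 1)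
    (hinj : ∀ w, ¬ Function.Injective w → H w = 0) :
    ∃ C : ℝ, ∀ n : ℕ, ∫ ω, (∑ f : Fin r → Fin n, H (fun i => ω (f i)) -
        n.descFactorial r * (∫ w, H w ∂Measure.pi fun _ : Fin r => μ) -
        (n : ℝ) ^ (r - 1) * ∑ k ∈ Finset.range n, ∑ j,
          (slotMean μ H j (ω k) - ∫ w, H w ∂Measure.pi fun _ : Fin r => μ)) ^ 2
      ∂Measure.infinitePi (fun _ : ℕ => μ) ≤ C * (n : ℝ) ^ (2 * r - 2) := by
  classical
  set θ := ∫ w, H w ∂Measure.pi fun _ : Fin r => μ with hθ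
  have hθ1 : |θ| ≤ 1 := by
    simpa using norm_integral_le_of_norm_le_const (μ := Measure.pi fun _ : Fin r => μ)
      (f := H) (C := 1) (Eventually.of_forall hB)
  set g : Fin r → E → ℝ := fun j z => slotMean μ H j z - θ with hg
  have hgm (j : Fin r) : Measurable (g j) := (measurable_slotMean μ hH j).sub_const θ
  have hg2 (j : Fin r) (z : E) : |g j z| ≤ 2 :=
    (abs_sub _ _).trans (by linarith [abs_slotMean_le μ hB j z])
  have hg0 (j : Fin r) : ∫ z, g j z ∂μ = 0 := by
    rw [hg, integral_sub (integrable_of_abs_le (measurable_slotMean μ hH j)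
      (abs_slotMean_le μ hB j)) (integrable_const _), integral_slotMean μ hH hB]
    simp [hθ]
  -- Subtracting the one-variable projections makes the mean of `D` given any single argument
  -- vanish; this is the only degeneracy the second moment bound needs.
  set D : (Fin r → E) → ℝ := fun w => H w - θ - ∑ j, g j (w j) with hDdef
  have hD : Measurable D := by fun_prop
  have hsum (w : Fin r → E) : |∑ j, g j (w j)| ≤ 2 * r :=
    (Finset.abs_sum_le_sum_abs _ _).trans <| (Finset.sum_le_sum fun j _ => hg2 j (w j)).trans <| by
      simp [mul_comm]
  have hD2 (w : Fin r → E) : |D w| ≤ 2 + 2 * r :=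
    (abs_sub _ _).trans <| add_le_add ((abs_sub _ _).trans (by linarith [hB w])) (hsum w)
  have hup (a : Fin r) (z : E) : Measurable fun w : Fin r → E => Function.update w a z :=
    (measurable_update_pair a).comp (measurable_const.prodMk measurable_id)
  have hD0 (a : Fin r) (z : E) : slotMean μ D a z = 0 := by
    have h1 : Integrable (fun w : Fin r → E => H (Function.update w a z) - θ)
        (Measure.pi fun _ : Fin r => μ) :=
      (integrable_of_abs_le (hH.comp (hup a z)) fun w => hB _).sub (integrable_const _)
    have h2 (j : Fin r) : Integrable (fun w : Fin r → E => g j (Function.update w a z j))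
        (Measure.pi fun _ : Fin r => μ) :=
      integrable_of_abs_le ((hgm j).comp ((measurable_pi_apply j).comp (hup a z))) fun w => hg2 j _
    have h3 (j : Fin r) : ∫ w : Fin r → E, g j (Function.update w a z j)
        ∂(Measure.pi fun _ : Fin r => μ) = if j = a then g a z else 0 := by
      split_ifs with h
      · subst h; simp
      · have he := measurePreserving_eval (fun _ : Fin r => μ) j
        have := integral_map (μ := Measure.pi fun _ : Fin r => μ) (f := g j)
          he.measurable.aemeasurable (hgm j).aestronglyMeasurable
        rw [he.map_eq, hg0] at this
        simpa [h] using this.symm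
    simp only [slotMean, hDdef]
    rw [integral_sub h1 (integrable_finsetSum _ fun j _ => h2 j),
      integral_finsetSum _ fun j _ => h2 j]
    simp only [h3]
    rw [integral_sub (integrable_of_abs_le (by exact hH.comp (hup a z)) fun w => hB _)
      (integrable_const _)]
    simp [hg, slotMean]
  -- From (a - b)² ≤ 2a² + 2b²: `a` is the degenerate sum with `|D| ≤ 2 + 2r`, and `b` collects the
  -- projections over non-injective index maps. `H` vanishes on these maps, but the i.i.d. sum
  -- counts them.
  refine ⟨2 * ((2 + 2 * r) ^ 2 * r ^ 4) + 2 * (2 * r * r ^ 2) ^ 2, fun n => ?_⟩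
  have hpt (ω : ℕ → E) : ∑ f : Fin r → Fin n, H (fun i => ω (f i)) - n.descFactorial r * θ -
      (n : ℝ) ^ (r - 1) * ∑ k ∈ Finset.range n, ∑ j, g j (ω k) =
      ∑ f : Fin r → Fin n with Function.Injective f, D (fun i => ω (f i)) -
        ∑ f : Fin r → Fin n with ¬ Function.Injective f, ∑ j, g j (ω (f j)) := by
    have e1 : ∑ f : Fin r → Fin n, H (fun i => ω (f i)) =
        ∑ f : Fin r → Fin n with Function.Injective f, H (fun i => ω (f i)) := by
      rw [Finset.sum_filter]
      refine Finset.sum_congr rfl fun f _ => ?_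
      split_ifs with h
      · rfl
      · exact hinj _ fun h' => h fun a b hab => h' (congrArg (fun k : Fin n => ω k) hab)
    have e2 : (n : ℝ) ^ (r - 1) * ∑ k ∈ Finset.range n, ∑ j, g j (ω k) =
        ∑ f : Fin r → Fin n, ∑ j, g j (ω (f j)) := by
      obtain ⟨s, rfl⟩ : ∃ s, r = s + 1 := ⟨r - 1, by omega⟩
      rw [Finset.sum_comm, Finset.mul_sum, Finset.sum_comm (t := Finset.univ (α := Fin (s + 1)))]
      refine Finset.sum_congr rfl fun j _ => ?_
      rw [sum_apply_eq s n j fun k => g j (ω k), Finset.sum_range]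
      simp
    rw [e1, e2, ← Finset.sum_filter_add_sum_filter_not Finset.univ
      (fun f : Fin r → Fin n => Function.Injective f) fun f => ∑ j, g j (ω (f j))]
    simp only [hDdef, Finset.sum_sub_distrib, Finset.sum_const, card_injective, nsmul_eq_mul]
    ring
  have hN (ω : ℕ → E) : |∑ f : Fin r → Fin n with ¬ Function.Injective f,
      ∑ j, g j (ω (f j))| ≤ 2 * r * r ^ 2 * (n : ℝ) ^ (r - 1) := by
    refine (Finset.abs_sum_le_sum_abs _ _).trans <|
      (Finset.sum_le_sum fun f _ => hsum fun j => ω (f j)).trans ?_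
    rw [Finset.sum_const, nsmul_eq_mul, mul_comm, mul_assoc (2 * (r : ℝ))]
    refine mul_le_mul_of_nonneg_left ?_ (by positivity)
    exact_mod_cast card_not_injective_le r n
  have hA := integral_sq_sum_degenerate_le μ hr hD hD2 hD0 n
  have hm : Measurable fun ω : ℕ → E =>
      ∑ f : Fin r → Fin n with Function.Injective f, D (fun i => ω (f i)) := by fun_prop
  have hI : Integrable (fun ω : ℕ → E =>
      (∑ f : Fin r → Fin n with Function.Injective f, D (fun i => ω (f i))) ^ 2)
      (Measure.infinitePi fun _ : ℕ => μ) := by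
    refine integrable_of_abs_le (hm.pow_const 2)
      (B := (∑ f : Fin r → Fin n with Function.Injective f, (2 + 2 * (r : ℝ))) ^ 2) fun ω => ?_
    rw [abs_pow]
    gcongr
    exact (Finset.abs_sum_le_sum_abs _ _).trans (Finset.sum_le_sum fun f _ => hD2 _)
  calc _ ≤ ∫ ω, (2 * (∑ f : Fin r → Fin n with Function.Injective f, D (fun i => ω (f i))) ^ 2 +
        2 * (2 * r * r ^ 2) ^ 2 * (n : ℝ) ^ (2 * r - 2)) ∂Measure.infinitePi (fun _ : ℕ => μ) := by
        refine integral_mono_of_nonneg (Eventually.of_forall fun ω => sq_nonneg _)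
          ((hI.const_mul 2).add (integrable_const _)) (Eventually.of_forall fun ω => ?_)
        have h1 := sq_le_sq' (neg_le_of_abs_le (hN ω)) (le_of_abs_le (hN ω))
        have h2 : (n : ℝ) ^ (2 * r - 2) = ((n : ℝ) ^ (r - 1)) ^ 2 := by
          rw [← pow_mul]; congr 1; omega
        have h3 := hpt ω
        simp only [hg] at h3 h1
        simp only [h3, h2]
        nlinarith [sq_nonneg (∑ f : Fin r → Fin n with Function.Injective f, D (fun i => ω (f i)) +
          ∑ f : Fin r → Fin n with ¬ Function.Injective f, ∑ j, (slotMean μ H j (ω (f j)) - θ))]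
    _ ≤ _ := by
        rw [integral_add (hI.const_mul 2) (integrable_const _), integral_const_mul]
        simp only [integral_const, probReal_univ, one_smul]
        linarith

end Resampling

/-! ### Volumes of order simplices, with or without one coordinate fixed. -/

section OrderVolumes

/-- The uniform distribution on `[0,1]`. -/
noncomputable def unifMeasure : Measure ℝ := volume.restrict (Set.Ioc 0 1)

instance : IsProbabilityMeasure unifMeasure := ⟨by simp [unifMeasure]⟩

instance : NullSingletonClass unifMeasure := by unfold unifMeasure; infer_instance

lemma ae_unifMeasure_mem : ∀ᵐ x ∂unifMeasure, x ∈ Set.Ioc (0 : ℝ) 1 :=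
  ae_restrict_mem measurableSet_Ioc

/-- Endpoints are null, so `G` is constrained only on open intervals. This lets the inductions below
ignore boundary cases. -/
lemma lintegral_unifMeasure_eq {x y : ℝ} (hx : 0 ≤ x) (hxy : x ≤ y) (hy : y ≤ 1)
    {F : ℝ → ℝ} (hF : Continuous F) (hF0 : ∀ a ∈ Set.Ioc x y, 0 ≤ F a) {G : ℝ → ENNReal}
    (hin : ∀ a ∈ Set.Ioo x y, G a = ENNReal.ofReal (F a))
    (hout : ∀ a ∈ Set.Ioo (0 : ℝ) 1, a < x ∨ y < a → G a = 0) :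
    ∫⁻ a, G a ∂unifMeasure = ENNReal.ofReal (∫ a in x..y, F a) := by
  have hG : G =ᵐ[unifMeasure] (Set.Ioc x y).indicator fun a => ENNReal.ofReal (F a) := by
    have hfin : ∀ᵐ a ∂unifMeasure, a ∉ ({x, y, 1} : Set ℝ) :=
      compl_mem_ae_iff.2 ((Set.toFinite _).measure_zero _)
    filter_upwards [ae_unifMeasure_mem, hfin] with a ha hne
    simp only [Set.mem_insert_iff, Set.mem_singleton_iff, not_or] at hne
    have ha1 : a < 1 := lt_of_le_of_ne ha.2 hne.2.2
    by_cases h : a ∈ Set.Ioc x y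
    · rw [Set.indicator_of_mem h]
      exact hin a ⟨h.1, lt_of_le_of_ne h.2 hne.2.1⟩
    · rw [Set.indicator_of_notMem h]
      refine hout a ⟨ha.1, ha1⟩ ?_
      by_contra! hc
      exact h ⟨lt_of_le_of_ne hc.1 (Ne.symm hne.1), hc.2⟩
  rw [lintegral_congr_ae hG, lintegral_indicator measurableSet_Ioc, unifMeasure,
    Measure.restrict_restrict measurableSet_Ioc,
    Set.inter_eq_self_of_subset_left (Set.Ioc_subset_Ioc hx hy), intervalIntegral.integral_of_le hxy,
    ofReal_integral_eq_lintegral_ofReal (hF.integrableOn_Ioc)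
      ((ae_restrict_iff' measurableSet_Ioc).2 (Eventually.of_forall hF0))]

lemma pi_apply_eq_lintegral_cons {k : ℕ} {S : Set (Fin (k + 1) → ℝ)} (hS : MeasurableSet S) :
    (Measure.pi fun _ => unifMeasure) S =
      ∫⁻ a, (Measure.pi fun _ : Fin k => unifMeasure) {v | (Fin.cons a v : Fin (k + 1) → ℝ) ∈ S}
        ∂unifMeasure := by
  have h := (measurePreserving_piFinSuccAbove (fun _ : Fin (k + 1) => unifMeasure) 0).symm
  rw [← h.measure_preimage hS.nullMeasurableSet, Measure.prod_apply (h.measurable hS)]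
  refine lintegral_congr fun a => congrArg _ (Set.ext fun v => ?_)
  simp [MeasurableEquiv.piFinSuccAbove, Fin.insertNthEquiv]

lemma measurableSet_strictMono {k : ℕ} : MeasurableSet {w : Fin k → ℝ | StrictMono w} := by
  have : {w : Fin k → ℝ | StrictMono w} = ⋂ i, ⋂ j, ⋂ _ : i < j, {w | w i < w j} := by
    ext w; simp [StrictMono]
  rw [this]
  exact .iInter fun i => .iInter fun j => .iInter fun _ =>
    measurableSet_lt (measurable_pi_apply i) (measurable_pi_apply j)

lemma measurableSet_strictMono_gt {k : ℕ} (x : ℝ) :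
    MeasurableSet {w : Fin k → ℝ | StrictMono w ∧ ∀ i, x < w i} := by
  refine measurableSet_strictMono.inter (?_ : MeasurableSet {w : Fin k → ℝ | ∀ i, x < w i})
  have : {w : Fin k → ℝ | ∀ i, x < w i} = ⋂ i, {w | x < w i} := by ext w; simp
  rw [this]
  exact .iInter fun i => measurableSet_lt measurable_const (measurable_pi_apply i)

lemma strictMono_cons_gt_iff {k : ℕ} {a x : ℝ} {v : Fin k → ℝ} :
    (StrictMono (Fin.cons a v : Fin (k + 1) → ℝ) ∧
      ∀ i, x < (Fin.cons a v : Fin (k + 1) → ℝ) i) ↔ x < a ∧ StrictMono v ∧ ∀ i, a < v i := by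
  rw [Fin.strictMono_cons, Fin.forall_fin_succ]
  simp only [Fin.cons_zero, Fin.cons_succ]
  exact ⟨fun h => ⟨h.2.1, h.1.2, h.1.1⟩, fun h => ⟨⟨h.2.2, h.2.1⟩, h.1, fun i => h.1.trans (h.2.2 i)⟩⟩

/-- The lower bound `x` is what makes the induction close: the first coordinate `a` becomes the
lower bound of the remaining ones, and the volume is integrated over `a` in (x, 1). -/
lemma pi_strictMono_gt {k : ℕ} {x : ℝ} (hx : 0 ≤ x) (hx1 : x ≤ 1) :
    (Measure.pi fun _ => unifMeasure) {w : Fin k → ℝ | StrictMono w ∧ ∀ i, x < w i} =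
      ENNReal.ofReal ((1 - x) ^ k / k.factorial) := by
  induction k generalizing x with
  | zero =>
    have : {w : Fin 0 → ℝ | StrictMono w ∧ ∀ i, x < w i} = Set.univ := by
      ext w; simp [Subsingleton.strictMono]
    rw [this]
    simp
  | succ k ih =>
    rw [pi_apply_eq_lintegral_cons (measurableSet_strictMono_gt x)]
    simp only [Set.mem_ofPred_eq, strictMono_cons_gt_iff]
    rw [lintegral_unifMeasure_eq hx hx1 le_rfl (F := fun a => (1 - a) ^ k / k.factorial)
      (by fun_prop)]
    · congr 1
      rw [intervalIntegral.integral_div, intervalIntegral.integral_comp_sub_left (fun a => a ^ k),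
        integral_pow, Nat.factorial_succ]
      push_cast
      simp
      field_simp
    · intro a ha
      have : 0 ≤ 1 - a := by linarith [ha.2]
      positivity
    · intro a ha
      simp only [ha.1, true_and]
      exact ih (hx.trans ha.1.le) ha.2.le
    · intro a ha h
      have : ¬ x < a := by
        rcases h with h | h
        · exact h.not_gt
        · exact absurd h ha.2.not_gt
      simp [this]

lemma pi_strictMono (k : ℕ) :
    (Measure.pi fun _ => unifMeasure).real {w : Fin k → ℝ | StrictMono w} = 1 / k.factorial := by
  have h := pi_strictMono_gt (k := k) le_rfl zero_le_one
  have hae : {w : Fin k → ℝ | StrictMono w} =ᵐ[Measure.pi fun _ => unifMeasure]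
      {w : Fin k → ℝ | StrictMono w ∧ ∀ i, 0 < w i} := by
    have : ∀ᵐ w : Fin k → ℝ ∂(Measure.pi fun _ => unifMeasure), ∀ i, 0 < w i :=
      ae_all_iff.2 fun i => (measurePreserving_eval _ i).quasiMeasurePreserving.ae
        (ae_unifMeasure_mem.mono fun x hx => hx.1)
    filter_upwards [this] with w hw
    exact propext ⟨fun h => ⟨h, hw⟩, fun h => h.1⟩
  rw [measureReal_def, measure_congr hae, h, ENNReal.toReal_ofReal (by simp)]
  simp

lemma measurableSet_update_strictMono_gt {k : ℕ} (j : Fin k) (a x : ℝ) :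
    MeasurableSet {w : Fin k → ℝ | StrictMono (Function.update w j x) ∧
      ∀ i, a < Function.update w j x i} :=
  (measurable_update_pair j).comp (measurable_const.prodMk measurable_id)
    (measurableSet_strictMono_gt a)

/-- Peel off the first coordinate. If it is the fixed one, the others form a simplex above `x`;
otherwise it ranges over (a, x) and serves as the new lower bound, raising the power of x - a by
one. -/
lemma pi_update_strictMono_gt {s : ℕ} (j : Fin (s + 1)) {a x : ℝ} (ha : 0 ≤ a) (hax : a < x)
    (hx : x ≤ 1) :
    (Measure.pi fun _ => unifMeasure) {w : Fin (s + 1) → ℝ |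
      StrictMono (Function.update w j x) ∧ ∀ i, a < Function.update w j x i} =
      ENNReal.ofReal ((x - a) ^ (j : ℕ) / (j : ℕ).factorial *
        ((1 - x) ^ (s - (j : ℕ)) / (s - (j : ℕ)).factorial)) := by
  have hx1 : 0 ≤ 1 - x := by linarith
  induction s generalizing a with
  | zero =>
    obtain rfl : j = 0 := Fin.eq_zero j
    have : {w : Fin 1 → ℝ | StrictMono (Function.update w 0 x) ∧
        ∀ i, a < Function.update w 0 x i} = Set.univ := by
      ext w; simp [StrictMono, Fin.forall_fin_one, hax]
    rw [this]
    simp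
  | succ s ih =>
    rw [pi_apply_eq_lintegral_cons (measurableSet_update_strictMono_gt j a x)]
    cases j using Fin.cases with
    | zero =>
      simp only [Set.mem_ofPred_eq, Fin.update_cons_zero, strictMono_cons_gt_iff, hax, true_and]
      rw [pi_strictMono_gt (ha.trans hax.le) hx]
      simp
    | succ i =>
      simp only [Set.mem_ofPred_eq, ← Fin.cons_update, strictMono_cons_gt_iff]
      rw [lintegral_unifMeasure_eq ha hax.le hx (F := fun b => (x - b) ^ (i : ℕ) /
        (i : ℕ).factorial * ((1 - x) ^ (s - (i : ℕ)) / (s - (i : ℕ)).factorial)) (by fun_prop)]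
      · congr 1
        rw [intervalIntegral.integral_mul_const, intervalIntegral.integral_div,
          intervalIntegral.integral_comp_sub_left (fun b => b ^ (i : ℕ)), integral_pow,
          Fin.val_succ, Nat.factorial_succ, Nat.add_sub_add_right]
        push_cast
        simp only [sub_self, ne_eq, Nat.add_eq_zero_iff, one_ne_zero, and_false, not_false_eq_true,
          zero_pow, sub_zero]
        field_simp
      · intro b hb
        have : 0 ≤ x - b := by linarith [hb.2]
        positivity
      · intro b hb
        simp only [hb.1, true_and]
        exact ih i (ha.trans hb.1.le) hb.2
      · intro b hb h
        rcases h with h | h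
        · simp [h.not_gt]
        · have : {v : Fin (s + 1) → ℝ | a < b ∧ StrictMono (Function.update v i x) ∧
              ∀ k, b < Function.update v i x k} = ∅ := by
            ext v
            simp only [Set.mem_ofPred_eq, Set.mem_empty_iff_false, iff_false]
            exact fun hv => (by simpa using hv.2.2 i : b < x).not_gt h
          simp [this]

lemma measurableSet_update_strictMono {k : ℕ} (j : Fin k) (x : ℝ) :
    MeasurableSet {w : Fin k → ℝ | StrictMono (Function.update w j x)} :=
  (measurable_update_pair j).comp (measurable_const.prodMk measurable_id) measurableSet_strictMono

/-- The probability that uniform points are increasing, when the `j`-th is fixed at `x`. -/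
lemma pi_update_strictMono {r : ℕ} (j : Fin r) {x : ℝ} (hx : x ∈ Set.Ioc (0 : ℝ) 1) :
    (Measure.pi fun _ => unifMeasure).real {w : Fin r → ℝ | StrictMono (Function.update w j x)} =
      bernsteinProb r j x / (r - 1).factorial := by
  obtain ⟨s, rfl⟩ : ∃ s, r = s + 1 := ⟨r - 1, by have := j.pos; omega⟩
  have h := pi_update_strictMono_gt j le_rfl hx.1 hx.2
  have hae : {w : Fin (s + 1) → ℝ | StrictMono (Function.update w j x)}
      =ᵐ[Measure.pi fun _ => unifMeasure]
      {w : Fin (s + 1) → ℝ | StrictMono (Function.update w j x) ∧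
        ∀ i, 0 < Function.update w j x i} := by
    have : ∀ᵐ w : Fin (s + 1) → ℝ ∂(Measure.pi fun _ => unifMeasure), ∀ i, 0 < w i :=
      ae_all_iff.2 fun i => (measurePreserving_eval _ i).quasiMeasurePreserving.ae
        (ae_unifMeasure_mem.mono fun x hx => hx.1)
    filter_upwards [this] with w hw
    refine propext ⟨fun h => ⟨h, fun i => ?_⟩, fun h => h.1⟩
    rcases eq_or_ne i j with rfl | hij
    · simpa using hx.1
    · simpa [hij] using hw i
  have hx0 : 0 ≤ x := hx.1.le
  have hx1 : 0 ≤ 1 - x := by linarith [hx.2]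
  rw [measureReal_def, measure_congr hae, h, ENNReal.toReal_ofReal (by
    simp only [sub_zero]; positivity), bernsteinProb, Nat.add_sub_cancel,
    Nat.cast_choose ℝ (Nat.lt_succ_iff.1 j.2)]
  simp only [sub_zero]
  field_simp

end OrderVolumes

/-! ### The pattern kernel and its one-point projection. -/

section PatternKernel

/-- The uniform distribution on the unit square. -/
noncomputable def unifSquare : Measure (ℝ × ℝ) := unifMeasure.prod unifMeasure

instance : IsProbabilityMeasure unifSquare := by unfold unifSquare; infer_instance

open Classical in
/-- The indicator that the points `w`, in this order from left to right, form the pattern `π`. -/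
noncomputable def patternKernel {r : ℕ} (π : Equiv.Perm (Fin r)) (w : Fin r → ℝ × ℝ) : ℝ :=
  if StrictMono (fun i => (w i).1) ∧ StrictMono (fun i => (w (π.symm i)).2) then 1 else 0

variable {r : ℕ} (π : Equiv.Perm (Fin r))

lemma measurable_patternKernel : Measurable (patternKernel π) := by
  refine Measurable.ite ?_ measurable_const measurable_const
  refine MeasurableSet.inter (measurableSet_preimage (f := fun (w : Fin r → ℝ × ℝ) i => (w i).1)
    (by fun_prop) measurableSet_strictMono) (measurableSet_preimage
      (f := fun (w : Fin r → ℝ × ℝ) i => (w (π.symm i)).2) (by fun_prop) measurableSet_strictMono)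

lemma abs_patternKernel_le (w : Fin r → ℝ × ℝ) : |patternKernel π w| ≤ 1 := by
  unfold patternKernel; split_ifs <;> simp

lemma patternKernel_eq_zero_of_not_injective (w : Fin r → ℝ × ℝ) (hw : ¬ Function.Injective w) :
    patternKernel π w = 0 := by
  refine if_neg fun h => hw fun a b hab => h.1.injective (congrArg Prod.fst hab)

/-- Events on the abscissas and on the ordinates are independent. -/
lemma pi_unifSquare_inter {A B : Set (Fin r → ℝ)} (hA : MeasurableSet A) (hB : MeasurableSet B) :
    (Measure.pi fun _ : Fin r => unifSquare).real
      {w | (fun i => (w i).1) ∈ A ∧ (fun i => (w i).2) ∈ B} =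
    (Measure.pi fun _ => unifMeasure).real A * (Measure.pi fun _ => unifMeasure).real B := by
  have h := measurePreserving_arrowProdEquivProdArrow ℝ ℝ (Fin r) (fun _ => unifMeasure)
    (fun _ => unifMeasure)
  rw [← measureReal_prod_prod, measureReal_def, measureReal_def,
    ← h.measure_preimage (hA.prod hB).nullMeasurableSet]
  rfl

lemma pi_comp_perm {A : Set (Fin r → ℝ)} (hA : MeasurableSet A) (σ : Equiv.Perm (Fin r)) :
    (Measure.pi fun _ => unifMeasure).real {v : Fin r → ℝ | (fun i => v (σ i)) ∈ A} =
      (Measure.pi fun _ => unifMeasure).real A := by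
  have h := measurePreserving_comp_injective unifMeasure σ.injective
  rw [Measure.infinitePi_eq_pi] at h
  rw [measureReal_def, measureReal_def, ← h.measure_preimage hA.nullMeasurableSet]
  rfl

/-- Sorting by abscissa and sorting by height are independent events, each of probability 1/r!. -/
lemma integral_patternKernel :
    ∫ w, patternKernel π w ∂Measure.pi (fun _ => unifSquare) =
      1 / r.factorial * (1 / r.factorial) := by
  have hm : MeasurableSet {v : Fin r → ℝ | StrictMono fun i => v (π.symm i)} :=
    measurableSet_preimage (f := fun (v : Fin r → ℝ) i => v (π.symm i)) (by fun_prop)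
      measurableSet_strictMono
  have hk : patternKernel π = Set.indicator {w : Fin r → ℝ × ℝ |
      (fun i => (w i).1) ∈ {v : Fin r → ℝ | StrictMono v} ∧
      (fun i => (w i).2) ∈ {v : Fin r → ℝ | StrictMono fun i => v (π.symm i)}} 1 := by
    ext w
    simp [patternKernel, Set.indicator]
  rw [hk, integral_indicator_one, pi_unifSquare_inter measurableSet_strictMono hm, pi_strictMono]
  · congr 1
    exact (pi_comp_perm measurableSet_strictMono π.symm).trans (pi_strictMono r)
  · exact (measurableSet_preimage (f := fun (w : Fin r → ℝ × ℝ) i => (w i).1) (by fun_prop)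
      measurableSet_strictMono).inter
      (measurableSet_preimage (f := fun (w : Fin r → ℝ × ℝ) i => (w i).2) (by fun_prop) hm)

lemma slotMean_patternKernel (j : Fin r) {z : ℝ × ℝ} (hx : z.1 ∈ Set.Ioc (0 : ℝ) 1)
    (hy : z.2 ∈ Set.Ioc (0 : ℝ) 1) :
    slotMean unifSquare (patternKernel π) j z =
      bernsteinProb r j z.1 / (r - 1).factorial *
        (bernsteinProb r (π j) z.2 / (r - 1).factorial) := by
  have hm : MeasurableSet {v : Fin r → ℝ | (fun i => v (π.symm i)) ∈
      {v : Fin r → ℝ | StrictMono (Function.update v (π j) z.2)}} :=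
    measurableSet_preimage (f := fun (v : Fin r → ℝ) i => v (π.symm i)) (by fun_prop)
      (measurableSet_update_strictMono (π j) z.2)
  have hk : (fun w => patternKernel π (Function.update w j z)) = Set.indicator
      {w : Fin r → ℝ × ℝ |
      (fun i => (w i).1) ∈ {v : Fin r → ℝ | StrictMono (Function.update v j z.1)} ∧
      (fun i => (w i).2) ∈ {v : Fin r → ℝ | (fun i => v (π.symm i)) ∈
        {v : Fin r → ℝ | StrictMono (Function.update v (π j) z.2)}}} 1 := by
    ext w
    have h1 : (fun i => (Function.update w j z i).1) =
        Function.update (fun i => (w i).1) j z.1 := by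
      funext i
      rcases eq_or_ne i j with rfl | h <;> simp [*]
    have h2 : (fun i => (Function.update w j z (π.symm i)).2) =
        -- Fixing the point of index `j` fixes the height of rank `π j` once heights are listed in
        -- increasing order.
        Function.update (fun i => (w (π.symm i)).2) (π j) z.2 := by
      funext i
      rcases eq_or_ne i (π j) with rfl | h
      · simp
      · have : π.symm i ≠ j := fun h' => h (by rw [← h', Equiv.apply_symm_apply])
        simp [h, this]
    simp only [patternKernel, h1, h2, Set.indicator, Set.mem_ofPred_eq, Pi.one_apply]
  rw [slotMean, hk, integral_indicator_one,
    pi_unifSquare_inter (measurableSet_update_strictMono j z.1) hm,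
    pi_comp_perm (measurableSet_update_strictMono (π j) z.2) π.symm, pi_update_strictMono j hx,
    pi_update_strictMono (π j) hy]
  · exact (measurableSet_preimage (f := fun (w : Fin r → ℝ × ℝ) i => (w i).1) (by fun_prop)
      (measurableSet_update_strictMono j z.1)).inter
      (measurableSet_preimage (f := fun (w : Fin r → ℝ × ℝ) i => (w i).2) (by fun_prop) hm)

lemma ae_unifSquare_mem :
    ∀ᵐ z ∂unifSquare, z.1 ∈ Set.Ioc (0 : ℝ) 1 ∧ z.2 ∈ Set.Ioc (0 : ℝ) 1 :=
  (Measure.quasiMeasurePreserving_fst.ae ae_unifMeasure_mem).and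
    (Measure.quasiMeasurePreserving_snd.ae ae_unifMeasure_mem)

/-- The projection of a pattern count on a single point. -/
noncomputable def centeredProj (z : ℝ × ℝ) : ℝ :=
  (patternProj π z.1 z.2 - 1 / r.factorial) / (r - 1).factorial

lemma continuous_centeredProj : Continuous (centeredProj π) := by
  unfold centeredProj patternProj bernsteinProb
  fun_prop

/-- The mean is subtracted once per slot, and r/(r!)² = 1/(r! (r-1)!) is exactly the centering of
`patternProj` after division by (r-1)!. -/
lemma sum_slotMean_patternKernel (hr : 0 < r) {z : ℝ × ℝ} (hx : z.1 ∈ Set.Ioc (0 : ℝ) 1)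
    (hy : z.2 ∈ Set.Ioc (0 : ℝ) 1) :
    ∑ j, (slotMean unifSquare (patternKernel π) j z -
      ∫ w, patternKernel π w ∂Measure.pi (fun _ => unifSquare)) = centeredProj π z := by
  simp only [slotMean_patternKernel π _ hx hy, integral_patternKernel, centeredProj, patternProj,
    Finset.sum_sub_distrib]
  have hf : (r.factorial : ℝ) = r * (r - 1).factorial := by
    rw [← Nat.mul_factorial_pred hr.ne']; push_cast; rfl
  have hr' : (r : ℝ) ≠ 0 := by exact_mod_cast hr.ne'
  simp only [div_mul_div_comm, ← Finset.sum_div]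
  simp only [Finset.sum_const, Finset.card_univ, Fintype.card_fin, nsmul_eq_mul, hf]
  field_simp

lemma integral_centeredProj (hr : 0 < r) : ∫ z, centeredProj π z ∂unifSquare = 0 := by
  rw [← integral_congr_ae (ae_unifSquare_mem.mono fun z hz =>
    sum_slotMean_patternKernel π hr hz.1 hz.2), integral_finsetSum]
  · refine Finset.sum_eq_zero fun j _ => ?_
    rw [integral_sub (integrable_of_abs_le (measurable_slotMean _ (measurable_patternKernel π) j)
      (abs_slotMean_le _ (abs_patternKernel_le π) j)) (integrable_const _),
      integral_slotMean _ (measurable_patternKernel π) (abs_patternKernel_le π)]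
    simp
  · exact fun j _ => (integrable_of_abs_le (measurable_slotMean _ (measurable_patternKernel π) j)
      (abs_slotMean_le _ (abs_patternKernel_le π) j)).sub (integrable_const _)

end PatternKernel

/-! ### Expectations of functions of a finite-valued variable with measurable fibres. -/

section FiniteExpectation

lemma integral_comp_eq_sum {Ω α E : Type*} [MeasurableSpace Ω] {P : Measure Ω} [IsFiniteMeasure P]
    [Fintype α] [NormedAddCommGroup E] [NormedSpace ℝ E] [CompleteSpace E] {τ : Ω → α}
    (hτ : ∀ a, MeasurableSet (τ ⁻¹' {a})) (F : α → E) :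
    ∫ ω, F (τ ω) ∂P = ∑ a, P.real (τ ⁻¹' {a}) • F a := by
  classical
  have h (ω : Ω) : F (τ ω) = ∑ a, (τ ⁻¹' {a}).indicator (fun _ => F a) ω := by
    simp [Set.indicator]
  simp only [h]
  rw [integral_finsetSum _ fun a _ => (integrable_const _).indicator (hτ a)]
  simp only [integral_indicator_const _ (hτ _)]

lemma measurable_comp_of_preimage_singleton {Ω α E : Type*} [MeasurableSpace Ω] [Countable α]
    [MeasurableSpace E] {τ : Ω → α} (hτ : ∀ a, MeasurableSet (τ ⁻¹' {a})) (F : α → E) :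
    Measurable fun ω => F (τ ω) := by
  let _ : MeasurableSpace α := ⊤
  exact (measurable_from_top (f := F)).comp (measurable_to_countable' hτ)

lemma sum_prob_eq_one {Ω α : Type*} [MeasurableSpace Ω] {P : Measure Ω} [IsProbabilityMeasure P]
    [Fintype α] {τ : Ω → α} (hτ : ∀ a, MeasurableSet (τ ⁻¹' {a})) :
    ∑ a, P.real (τ ⁻¹' {a}) = 1 := by
  rw [sum_measureReal_preimage_singleton _ fun a _ => hτ a]
  simp

end FiniteExpectation

/-! ### Uniform permutations from i.i.d. points, and their pattern counts. -/

section InducedPermutation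

/-- Occurrences of `π` in `τ`, listed from left to right. -/
lemma occ_eq_card {r n : ℕ} (π : Equiv.Perm (Fin r)) (τ : Equiv.Perm (Fin n)) :
    occ π τ = (Finset.univ.filter fun g : Fin r → Fin n =>
      StrictMono g ∧ StrictMono fun i => τ (g (π.symm i))).card := by
  classical
  have hiff (g : Fin r → Fin n) : (∀ j k, π j < π k ↔ τ (g j) < τ (g k)) ↔
      StrictMono fun i => τ (g (π.symm i)) := by
    constructor
    · intro h a b hab
      exact (h _ _).1 (by simpa using hab)
    · intro h j k
      simpa using (h.lt_iff_lt (a := π j) (b := π k)).symm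
  refine (Finset.card_bij (fun g _ => Finset.univ.image g) ?_ ?_ ?_).symm
  · intro g hg
    obtain ⟨-, hg, hτ⟩ := Finset.mem_filter.1 hg
    have hc : (Finset.univ.image g).card = r := by
      rw [Finset.card_image_of_injective _ hg.injective, Finset.card_univ, Fintype.card_fin]
    refine Finset.mem_filter.2 ⟨Finset.mem_univ _, hc, ?_⟩
    rw [← Finset.orderEmbOfFin_unique hc (f := g) (fun i => by simp) hg, hiff]
    exact hτ
  · intro g hg g' hg' h
    obtain ⟨-, hg, -⟩ := Finset.mem_filter.1 hg
    obtain ⟨-, hg', -⟩ := Finset.mem_filter.1 hg'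
    have hc : (Finset.univ.image g).card = r := by
      rw [Finset.card_image_of_injective _ hg.injective, Finset.card_univ, Fintype.card_fin]
    rw [Finset.orderEmbOfFin_unique hc (f := g) (fun i => by simp) hg,
      Finset.orderEmbOfFin_unique hc (f := g') (fun i => by rw [h]; simp) hg']
  · intro I hI
    obtain ⟨-, hc, h⟩ := Finset.mem_filter.1 hI
    refine ⟨I.orderEmbOfFin hc, Finset.mem_filter.2 ⟨Finset.mem_univ _,
      (I.orderEmbOfFin hc).strictMono, (hiff _).1 h⟩, ?_⟩
    exact Finset.coe_injective (by simp)

lemma strictMono_comp_iff_of_sorted {r n : ℕ} {x : Fin n → ℝ} {σ : Equiv.Perm (Fin n)}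
    (hσ : StrictMono fun i => x (σ i)) (g : Fin r → Fin n) :
    StrictMono (fun i => x (g i)) ↔ StrictMono fun i => σ.symm (g i) := by
  have h (a b : Fin n) : x a < x b ↔ σ.symm a < σ.symm b := by
    simpa using hσ.lt_iff_lt (a := σ.symm a) (b := σ.symm b)
  simp only [StrictMono, h]

/-- A point configuration and its permutation have the same pattern counts. -/
lemma occ_eq_sum_patternKernel {r n : ℕ} (π : Equiv.Perm (Fin r)) {w : Fin n → ℝ × ℝ}
    {σ σ' : Equiv.Perm (Fin n)} (hσ : StrictMono fun i => (w (σ i)).1)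
    (hσ' : StrictMono fun i => (w (σ' i)).2) :
    (occ π (σ'⁻¹ * σ) : ℝ) = ∑ f : Fin r → Fin n, patternKernel π fun i => w (f i) := by
  classical
  rw [occ_eq_card]
  simp only [patternKernel, Finset.sum_boole]
  norm_cast
  -- `g` lists positions in the permutation, `σ ∘ g` the labels of the points there. As
  -- `patternKernel` requires increasing abscissas, each occurrence comes from exactly one index
  -- map.
  refine Finset.card_bij (fun g _ i => σ (g i)) ?_ ?_ ?_
  · intro g hg
    obtain ⟨-, h1, h2⟩ := Finset.mem_filter.1 hg
    refine Finset.mem_filter.2 ⟨Finset.mem_univ _, hσ.comp h1, ?_⟩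
    exact (strictMono_comp_iff_of_sorted (x := fun i => (w i).2) hσ'
      (fun i => σ (g (π.symm i)))).2 h2
  · intro g _ g' _ h
    exact funext fun i => σ.injective (congrFun h i)
  · intro f hf
    obtain ⟨-, h1, h2⟩ := Finset.mem_filter.1 hf
    refine ⟨fun i => σ.symm (f i), Finset.mem_filter.2 ⟨Finset.mem_univ _, ?_, ?_⟩, by simp⟩
    · exact (strictMono_comp_iff_of_sorted (x := fun i => (w i).1) hσ f).1 h1
    · have := (strictMono_comp_iff_of_sorted (x := fun i => (w i).2) hσ'
        (fun i => f (π.symm i))).1 h2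
      simpa using this

lemma sort_eq_of_strictMono {n : ℕ} {x : Fin n → ℝ} {σ : Equiv.Perm (Fin n)}
    (hσ : StrictMono fun i => x (σ i)) : Tuple.sort x = σ := by
  have hinj : Function.Injective x := fun a b h => by
    have := hσ.injective (a₁ := σ.symm a) (a₂ := σ.symm b) (by simpa using h)
    simpa using this
  have h := Tuple.unique_monotone (Tuple.monotone_sort x) (τ := σ) hσ.monotone
  exact Equiv.ext fun i => hinj (congrFun h i)

lemma measurableSet_sort_eq {n : ℕ} (σ : Equiv.Perm (Fin n)) :
    MeasurableSet {x : Fin n → ℝ | Tuple.sort x = σ} := by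
  have : {x : Fin n → ℝ | Tuple.sort x = σ} = (⋂ i, ⋂ j, ⋂ _ : i ≤ j, {x | x (σ i) ≤ x (σ j)}) ∩
      ⋂ i, ⋂ j, ⋂ _ : i < j, ({x | x (σ i) = x (σ j)}ᶜ ∪ {_x | σ i < σ j}) := by
    ext x
    simp only [Set.mem_ofPred_eq, eq_comm (b := σ), Tuple.eq_sort_iff]
    simp [Monotone, imp_iff_not_or]
  rw [this]
  refine .inter (.iInter fun i => .iInter fun j => .iInter fun _ =>
    measurableSet_le (measurable_pi_apply _) (measurable_pi_apply _)) (.iInter fun i => .iInter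
    fun j => .iInter fun _ => .union (.compl ?_) (.const _))
  exact measurableSet_eq_fun (measurable_pi_apply _) (measurable_pi_apply _)

/-- An i.i.d. sequence of uniform points of the square. -/
noncomputable abbrev pointMeasure : Measure (ℕ → ℝ × ℝ) := Measure.infinitePi fun _ => unifSquare

/-- The permutation whose graph has the same relative order as the first `n` points. -/
noncomputable def inducedPerm (n : ℕ) (ω : ℕ → ℝ × ℝ) : Equiv.Perm (Fin n) :=
  (Tuple.sort fun i : Fin n => (ω i).2)⁻¹ * Tuple.sort fun i : Fin n => (ω i).1

/-- The first `n` points are sorted by `p`. -/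
def sortedEvent {n : ℕ} (p : Equiv.Perm (Fin n) × Equiv.Perm (Fin n)) : Set (ℕ → ℝ × ℝ) :=
  {ω | StrictMono (fun i => (ω (p.1 i)).1) ∧ StrictMono (fun i => (ω (p.2 i)).2)}

lemma measurableSet_sortedEvent {n : ℕ} (p : Equiv.Perm (Fin n) × Equiv.Perm (Fin n)) :
    MeasurableSet (sortedEvent p) :=
  (measurableSet_preimage (f := fun (ω : ℕ → ℝ × ℝ) i => (ω (p.1 i)).1) (by fun_prop)
    measurableSet_strictMono).inter (measurableSet_preimage
      (f := fun (ω : ℕ → ℝ × ℝ) i => (ω (p.2 i)).2) (by fun_prop) measurableSet_strictMono)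

lemma pointMeasure_sortedEvent {n : ℕ} (p : Equiv.Perm (Fin n) × Equiv.Perm (Fin n)) :
    pointMeasure.real (sortedEvent p) = 1 / n.factorial * (1 / n.factorial) := by
  have h := measurePreserving_comp_injective unifSquare (Fin.val_injective (n := n))
  have hA (σ : Equiv.Perm (Fin n)) :
      MeasurableSet {v : Fin n → ℝ | (fun i => v (σ i)) ∈ {v : Fin n → ℝ | StrictMono v}} :=
    measurableSet_preimage (f := fun (v : Fin n → ℝ) i => v (σ i)) (by fun_prop)
      measurableSet_strictMono
  have hp := pi_unifSquare_inter (hA p.1) (hA p.2)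
  rw [pi_comp_perm measurableSet_strictMono, pi_comp_perm measurableSet_strictMono,
    pi_strictMono] at hp
  rw [← hp, measureReal_def, measureReal_def, ← h.measure_preimage]
  · rfl
  · refine MeasurableSet.nullMeasurableSet ?_
    exact (measurableSet_preimage (f := fun (w : Fin n → ℝ × ℝ) i => (w i).1) (by fun_prop)
      (hA p.1)).inter
      (measurableSet_preimage (f := fun (w : Fin n → ℝ × ℝ) i => (w i).2) (by fun_prop) (hA p.2))

lemma sort_eq_of_mem_sortedEvent {n : ℕ} {p : Equiv.Perm (Fin n) × Equiv.Perm (Fin n)}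
    {ω : ℕ → ℝ × ℝ} (h : ω ∈ sortedEvent p) :
    Tuple.sort (fun i : Fin n => (ω i).1) = p.1 ∧ Tuple.sort (fun i : Fin n => (ω i).2) = p.2 :=
  ⟨sort_eq_of_strictMono (x := fun i : Fin n => (ω i).1) h.1,
    sort_eq_of_strictMono (x := fun i : Fin n => (ω i).2) h.2⟩

lemma pairwiseDisjoint_sortedEvent {n : ℕ}
    (S : Set (Equiv.Perm (Fin n) × Equiv.Perm (Fin n))) : S.PairwiseDisjoint sortedEvent := by
  intro p _ p' _ hne
  refine Set.disjoint_left.2 fun ω h h' => hne ?_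
  obtain ⟨h1, h2⟩ := sort_eq_of_mem_sortedEvent h
  obtain ⟨h1', h2'⟩ := sort_eq_of_mem_sortedEvent h'
  exact Prod.ext (h1.symm.trans h1') (h2.symm.trans h2')

/-- The (n!)² events are disjoint and each has probability 1/(n!)², so they exhaust the space. Ties
are thereby null without a separate argument. -/
lemma ae_mem_sortedEvent (n : ℕ) : ∀ᵐ ω ∂pointMeasure,
    ∃ p : Equiv.Perm (Fin n) × Equiv.Perm (Fin n), ω ∈ sortedEvent p := by
  have h := measureReal_biUnion_finset (μ := pointMeasure) (s := Finset.univ)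
    (pairwiseDisjoint_sortedEvent (n := n) _) fun p _ => measurableSet_sortedEvent p
  simp only [pointMeasure_sortedEvent, Finset.sum_const, Finset.card_univ, Fintype.card_prod,
    Fintype.card_perm, Fintype.card_fin, nsmul_eq_mul, Nat.cast_mul] at h
  have hf : (n.factorial : ℝ) ≠ 0 := by positivity
  have h1 : pointMeasure.real (⋃ p ∈ (Finset.univ : Finset (Equiv.Perm (Fin n) ×
      Equiv.Perm (Fin n))), sortedEvent p) = 1 := by
    rw [h]; field_simp
  have h2 := (prob_compl_eq_zero_iff (Finset.measurableSet_biUnion _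
    fun p _ => measurableSet_sortedEvent p)).2 (by
      rw [← ENNReal.toReal_eq_one_iff]; exact h1)
  filter_upwards [mem_ae_iff.2 h2] with ω hω
  simpa using hω

lemma inducedPerm_eq_of_mem {n : ℕ} {p : Equiv.Perm (Fin n) × Equiv.Perm (Fin n)}
    {ω : ℕ → ℝ × ℝ} (h : ω ∈ sortedEvent p) : inducedPerm n ω = p.2⁻¹ * p.1 := by
  obtain ⟨h1, h2⟩ := sort_eq_of_mem_sortedEvent h
  rw [inducedPerm, h1, h2]

lemma ae_occ_inducedPerm {r : ℕ} (π : Equiv.Perm (Fin r)) (n : ℕ) : ∀ᵐ ω ∂pointMeasure,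
    (occ π (inducedPerm n ω) : ℝ) = ∑ f : Fin r → Fin n, patternKernel π fun i => ω (f i) := by
  filter_upwards [ae_mem_sortedEvent n] with ω ⟨p, hp⟩
  rw [inducedPerm_eq_of_mem hp]
  exact occ_eq_sum_patternKernel π (w := fun i => ω i) hp.1 hp.2

lemma measurableSet_inducedPerm (n : ℕ) (τ : Equiv.Perm (Fin n)) :
    MeasurableSet (inducedPerm n ⁻¹' {τ}) := by
  have : inducedPerm n ⁻¹' {τ} = ⋃ σ : Equiv.Perm (Fin n),
      {ω | Tuple.sort (fun i : Fin n => (ω i).1) = σ} ∩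
        {ω | Tuple.sort (fun i : Fin n => (ω i).2) = σ * τ⁻¹} := by
    ext ω
    simp only [inducedPerm, Set.mem_preimage, Set.mem_singleton_iff, Set.mem_iUnion,
      Set.mem_inter_iff, Set.mem_ofPred_eq, exists_eq_left']
    rw [inv_mul_eq_iff_eq_mul, eq_mul_inv_iff_mul_eq, eq_comm]
  rw [this]
  exact .iUnion fun σ => (measurableSet_preimage (f := fun (ω : ℕ → ℝ × ℝ) (i : Fin n) => (ω i).1)
    (by fun_prop) (measurableSet_sort_eq σ)).inter (measurableSet_preimage
      (f := fun (ω : ℕ → ℝ × ℝ) (i : Fin n) => (ω i).2) (by fun_prop) (measurableSet_sort_eq _))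

/-- The permutation of i.i.d. uniform points is uniform. -/
lemma isUniformPerm_inducedPerm (n : ℕ) : IsUniformPerm pointMeasure (inducedPerm n) := by
  refine ⟨measurableSet_inducedPerm n, ?_⟩
  have hf : (n.factorial : ℝ) ≠ 0 := by positivity
  -- The n! disjoint events indexed by (σ, σ τ⁻¹) all induce `τ`, which gives a lower bound 1/n!.
  -- Both sides sum to one, so every bound is an equality.
  have hle (τ : Equiv.Perm (Fin n)) (_ : τ ∈ Finset.univ) :
      1 / (n.factorial : ℝ) ≤ pointMeasure.real (inducedPerm n ⁻¹' {τ}) := by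
    have hinj : Function.Injective fun σ : Equiv.Perm (Fin n) => (σ, σ * τ⁻¹) :=
      fun a b h => congrArg Prod.fst h
    have h := measureReal_biUnion_finset (μ := pointMeasure)
      (s := Finset.univ.map ⟨fun σ : Equiv.Perm (Fin n) => (σ, σ * τ⁻¹), hinj⟩)
      (pairwiseDisjoint_sortedEvent (n := n) _) fun p _ => measurableSet_sortedEvent p
    simp only [pointMeasure_sortedEvent, Finset.sum_const, Finset.card_map, Finset.card_univ,
      Fintype.card_perm, Fintype.card_fin, nsmul_eq_mul] at h
    rw [← mul_assoc, mul_one_div_cancel hf, one_mul] at h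
    rw [← h]
    refine measureReal_mono (Set.iUnion₂_subset fun p hp ω hω => ?_)
    obtain ⟨σ, -, rfl⟩ := Finset.mem_map.1 hp
    simp [inducedPerm_eq_of_mem hω]
  have hsum : ∑ τ : Equiv.Perm (Fin n), 1 / (n.factorial : ℝ) =
      ∑ τ : Equiv.Perm (Fin n), pointMeasure.real (inducedPerm n ⁻¹' {τ}) := by
    rw [sum_measureReal_preimage_singleton _ fun τ _ => measurableSet_inducedPerm n τ]
    simp [Fintype.card_perm, hf]
  exact fun τ => ((Finset.sum_eq_sum_iff_of_le hle).1 hsum τ (Finset.mem_univ τ)).symm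

end InducedPermutation

/-! ### The covariance as a Gram matrix, and positivity of the variances. -/

section Covariance

lemma unifSquare_eq :
    unifSquare = (volume : Measure (ℝ × ℝ)).restrict (Set.Ioc 0 1 ×ˢ Set.Ioc 0 1) := by
  rw [unifSquare, unifMeasure, Measure.prod_restrict, ← Measure.volume_eq_prod]

lemma memLp_unifSquare {f : ℝ × ℝ → ℝ} (hf : Continuous f) (p : ENNReal) :
    MemLp f p unifSquare := by
  obtain ⟨C, hC⟩ := (isCompact_Icc.prod isCompact_Icc :
    IsCompact (Set.Icc (0 : ℝ) 1 ×ˢ Set.Icc (0 : ℝ) 1)).exists_bound_of_continuousOn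
      hf.continuousOn
  refine MemLp.of_bound hf.aestronglyMeasurable C (ae_unifSquare_mem.mono fun z hz => hC z ?_)
  exact ⟨Set.Ioc_subset_Icc_self hz.1, Set.Ioc_subset_Icc_self hz.2⟩

lemma integrable_unifSquare {f : ℝ × ℝ → ℝ} (hf : Continuous f) : Integrable f unifSquare :=
  memLp_one_iff_integrable.1 (memLp_unifSquare hf 1)

lemma patternCov_eq_integral {r s : ℕ} (π : Equiv.Perm (Fin r)) (ρ : Equiv.Perm (Fin s)) :
    patternCov π ρ = ∫ z, centeredProj π z * centeredProj ρ z ∂unifSquare := by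
  have hc : Continuous fun z => centeredProj π z * centeredProj ρ z :=
    (continuous_centeredProj π).mul (continuous_centeredProj ρ)
  rw [unifSquare, integral_prod _ (integrable_unifSquare hc), patternCov,
    intervalIntegral.integral_of_le zero_le_one]
  simp only [intervalIntegral.integral_of_le zero_le_one, unifMeasure, centeredProj]
  simp only [div_mul_div_comm, integral_div]

lemma sum_mul_patternCovMatrix {m : ℕ} {r : Fin m → ℕ} (π : ∀ i, Equiv.Perm (Fin (r i)))
    (t : Fin m → ℝ) : t ⬝ᵥ (patternCovMatrix π).mulVec t =
      ∫ z, (∑ i, t i * centeredProj (π i) z) ^ 2 ∂unifSquare := by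
  have hc (i j : Fin m) : Continuous fun z : ℝ × ℝ =>
      t i * centeredProj (π i) z * (t j * centeredProj (π j) z) :=
    ((continuous_centeredProj (π i)).const_mul _).mul ((continuous_centeredProj (π j)).const_mul _)
  simp only [sq, Finset.sum_mul_sum]
  rw [integral_finsetSum _ fun i _ => integrable_finsetSum _ fun j _ => integrable_unifSquare (hc i j)]
  simp only [integral_finsetSum _ fun j _ => integrable_unifSquare (hc _ j), dotProduct,
    Matrix.mulVec, patternCovMatrix, Matrix.of_apply, Finset.mul_sum, patternCov_eq_integral]
  refine Finset.sum_congr rfl fun i _ => Finset.sum_congr rfl fun j _ => ?_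
  rw [mul_comm _ (t j), ← integral_const_mul, ← integral_const_mul]
  congr 1
  ext z
  ring

lemma posSemidef_patternCovMatrix {m : ℕ} {r : Fin m → ℕ} (π : ∀ i, Equiv.Perm (Fin (r i))) :
    (patternCovMatrix π).PosSemidef := by
  refine Matrix.PosSemidef.of_dotProduct_mulVec_nonneg ?_ fun t => ?_
  · ext i j
    simp only [Matrix.conjTranspose_apply, patternCovMatrix, Matrix.of_apply, star_trivial,
      patternCov_eq_integral]
    simp only [mul_comm]
  · rw [star_trivial, sum_mul_patternCovMatrix]
    exact integral_nonneg fun z => sq_nonneg _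

lemma bernsteinProb_zero {r : ℕ} (k : Fin r) :
    bernsteinProb r k 0 = if (k : ℕ) = 0 then 1 else 0 := by
  unfold bernsteinProb
  split_ifs with h <;> simp [h]

/-- At the corner only the leftmost, lowest Bernstein term survives, so `patternProj` is 1/(r-1)! or
0 according to whether `π` fixes the first index. Neither equals 1/r! when r ≥ 2. -/
lemma centeredProj_zero_ne {r : ℕ} (hr : 2 ≤ r) (π : Equiv.Perm (Fin r)) :
    centeredProj π (0, 0) ≠ 0 := by
  have hf : (r.factorial : ℝ) = r * (r - 1).factorial := by
    rw [← Nat.mul_factorial_pred (by omega : r ≠ 0)]; push_cast; rfl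
  have hpos : (0 : ℝ) < (r - 1).factorial := by positivity
  have hr' : (2 : ℝ) ≤ r := by exact_mod_cast hr
  have hsum : ∑ k, bernsteinProb r k 0 * bernsteinProb r (π k) 0 =
      if (π ⟨0, by omega⟩ : ℕ) = 0 then 1 else 0 := by
    rw [Finset.sum_eq_single ⟨0, by omega⟩]
    · simp [bernsteinProb_zero]
    · intro k _ hk
      have : (k : ℕ) ≠ 0 := fun h => hk (Fin.ext h)
      simp [bernsteinProb_zero, this]
    · simp
  refine div_ne_zero ?_ hpos.ne'
  rw [patternProj, hsum, hf]
  split_ifs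
  · rw [mul_one, sub_ne_zero]
    intro h
    have := one_div_mul_one_div (r : ℝ) ((r - 1).factorial)
    rw [← this] at h
    have h2 : (1 : ℝ) = 1 / r := mul_right_cancel₀ (one_div_pos.2 hpos).ne' (by rw [← h, one_mul])
    rw [eq_div_iff (by positivity)] at h2
    linarith
  · simp only [mul_zero, zero_sub, neg_ne_zero]
    positivity

/-- Zero variance would make the continuous projection vanish almost everywhere on the square, hence
on its closure, contradicting its value at the corner. -/
lemma patternCov_self_pos {r : ℕ} (hr : 2 ≤ r) (π : Equiv.Perm (Fin r)) :
    0 < patternCov π π := by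
  have hc := continuous_centeredProj π
  have hnn : 0 ≤ fun z => centeredProj π z * centeredProj π z := fun z => mul_self_nonneg _
  rw [patternCov_eq_integral]
  refine lt_of_le_of_ne (integral_nonneg hnn) fun h => centeredProj_zero_ne hr π ?_
  have h0 := (integral_eq_zero_iff_of_nonneg hnn (integrable_unifSquare (hc.mul hc))).1 h.symm
  have h1 : centeredProj π =ᵐ[volume.restrict (Set.Ioo (0 : ℝ) 1 ×ˢ Set.Ioo (0 : ℝ) 1)]
      fun _ => 0 := by
    rw [unifSquare_eq] at h0
    refine ae_restrict_of_ae_restrict_of_subset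
      (Set.prod_mono Set.Ioo_subset_Ioc_self Set.Ioo_subset_Ioc_self) (h0.mono fun z hz => ?_)
    exact mul_self_eq_zero.1 hz
  have h2 := (Measure.eqOn_open_of_ae_eq h1 (isOpen_Ioo.prod isOpen_Ioo) hc.continuousOn
    continuousOn_const).closure hc continuous_const
  refine h2 ?_
  rw [closure_prod_eq, closure_Ioo zero_ne_one]
  simp

end Covariance

/-! ### The central limit theorem for uniform permutations. -/

section UniformCLT

variable {r : ℕ}

lemma ae_pointMeasure_mem : ∀ᵐ ω ∂pointMeasure,
    ∀ k, (ω k).1 ∈ Set.Ioc (0 : ℝ) 1 ∧ (ω k).2 ∈ Set.Ioc (0 : ℝ) 1 :=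
  ae_all_iff.2 fun k => (measurePreserving_eval_infinitePi
    (fun _ : ℕ => unifSquare) k).quasiMeasurePreserving.ae
    ae_unifSquare_mem

lemma exists_occ_projection_bound (hr : 0 < r) (π : Equiv.Perm (Fin r)) :
    ∃ C : ℝ, ∀ n : ℕ, ∫ ω, ((occ π (inducedPerm n ω) : ℝ) - n.choose r / r.factorial -
      (n : ℝ) ^ (r - 1) * ∑ k ∈ Finset.range n, centeredProj π (ω k)) ^ 2 ∂pointMeasure ≤
      C * (n : ℝ) ^ (2 * r - 2) := by
  obtain ⟨C, hC⟩ := exists_hoeffding_projection_bound unifSquare hr (measurable_patternKernel π)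
    (abs_patternKernel_le π) (patternKernel_eq_zero_of_not_injective π)
  refine ⟨C, fun n => (integral_congr_ae ?_).trans_le (hC n)⟩
  filter_upwards [ae_occ_inducedPerm π n, ae_pointMeasure_mem] with ω h1 h2
  have h3 : (n.descFactorial r : ℝ) * (1 / r.factorial * (1 / r.factorial)) =
      n.choose r / r.factorial := by
    rw [Nat.descFactorial_eq_factorial_mul_choose]
    push_cast
    field_simp
  rw [h1, integral_patternKernel, h3]
  congr 3
  refine Finset.sum_congr rfl fun k _ => ?_
  rw [← sum_slotMean_patternKernel π hr (h2 k).1 (h2 k).2, integral_patternKernel]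

/-- The normalized count of a pattern minus a normalized i.i.d. sum. -/
noncomputable def projError (π : Equiv.Perm (Fin r)) (n : ℕ) (ω : ℕ → ℝ × ℝ) : ℝ :=
  normalizedOcc π (inducedPerm n ω) - (√n)⁻¹ * ∑ k ∈ Finset.range n, centeredProj π (ω k)

lemma exists_integral_projError_sq_le (hr : 0 < r) (π : Equiv.Perm (Fin r)) :
    ∃ C : ℝ, ∀ n : ℕ, 0 < n → ∫ ω, projError π n ω ^ 2 ∂pointMeasure ≤ C / n := by
  obtain ⟨C, hC⟩ := exists_occ_projection_bound hr π
  refine ⟨C, fun n hn => ?_⟩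
  have hn' : (0 : ℝ) < n := by exact_mod_cast hn
  have hsq : √(n : ℝ) ^ 2 = n := Real.sq_sqrt hn'.le
  have hsp : 0 < √(n : ℝ) := Real.sqrt_pos.2 hn'
  have hpow : (n : ℝ) ^ ((r : ℝ) - 1 / 2) = (n : ℝ) ^ (r - 1) * √n := by
    rw [Real.sqrt_eq_rpow, ← Real.rpow_natCast, ← Real.rpow_add hn', Nat.cast_sub hr]
    congr 1
    push_cast
    ring
  have hpt (ω : ℕ → ℝ × ℝ) : projError π n ω ^ 2 =
      ((occ π (inducedPerm n ω) : ℝ) - n.choose r / r.factorial -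
      (n : ℝ) ^ (r - 1) * ∑ k ∈ Finset.range n, centeredProj π (ω k)) ^ 2 /
        ((n : ℝ) ^ (2 * r - 2) * n) := by
    have h2 : (n : ℝ) ^ (2 * r - 2) * n = ((n : ℝ) ^ (r - 1) * √n) ^ 2 := by
      rw [mul_pow, hsq, ← pow_mul]; congr 2; omega
    rw [h2, ← div_pow, projError, normalizedOcc, hpow]
    congr 1
    field_simp
  simp only [hpt, integral_div]
  rw [div_le_div_iff₀ (by positivity) hn']
  calc _ ≤ C * (n : ℝ) ^ (2 * r - 2) * n := by gcongr; exact hC n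
    _ = _ := by ring

lemma measurable_comp_inducedPerm {E : Type*} [MeasurableSpace E] (n : ℕ)
    (F : Equiv.Perm (Fin n) → E) : Measurable fun ω => F (inducedPerm n ω) :=
  measurable_comp_of_preimage_singleton (measurableSet_inducedPerm n) F

lemma memLp_centeredProj_comp (π : Equiv.Perm (Fin r)) (k : ℕ) :
    MemLp (fun ω : ℕ → ℝ × ℝ => centeredProj π (ω k)) 2 pointMeasure :=
  (memLp_unifSquare (continuous_centeredProj π) 2).comp_measurePreserving
    (measurePreserving_eval_infinitePi _ k)

lemma memLp_comp_inducedPerm (n : ℕ) (F : Equiv.Perm (Fin n) → ℝ) :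
    MemLp (fun ω => F (inducedPerm n ω)) 2 pointMeasure :=
  MemLp.of_bound (measurable_comp_inducedPerm n F).aestronglyMeasurable
    (∑ σ, ‖F σ‖) (Eventually.of_forall fun _ =>
      Finset.single_le_sum (f := fun σ => ‖F σ‖) (fun _ _ => norm_nonneg _) (Finset.mem_univ _))

lemma memLp_projError (π : Equiv.Perm (Fin r)) (n : ℕ) :
    MemLp (projError π n) 2 pointMeasure :=
  (memLp_comp_inducedPerm n _).sub
    ((memLp_finsetSum _ fun k _ => memLp_centeredProj_comp π k).const_mul _)

/-- Chebyshev's inequality. -/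
lemma tendstoInMeasure_of_integral_sq_le {Ω : Type*} [MeasurableSpace Ω] {P : Measure Ω}
    [IsProbabilityMeasure P] {Y : ℕ → Ω → ℝ} (hY : ∀ n, MemLp (Y n) 2 P) {b : ℕ → ℝ}
    (hb : Tendsto b atTop (𝓝 0)) (hle : ∀ᶠ n in atTop, ∫ ω, Y n ω ^ 2 ∂P ≤ b n) :
    TendstoInMeasure P Y atTop 0 := by
  rw [tendstoInMeasure_iff_measureReal_norm]
  intro ε hε
  refine squeeze_zero' (Eventually.of_forall fun n => measureReal_nonneg) ?_
    (by simpa using hb.div_const (ε ^ 2))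
  filter_upwards [hle] with n hn
  have hm := mul_meas_ge_le_integral_of_nonneg (μ := P) (f := fun ω => Y n ω ^ 2)
    (Eventually.of_forall fun ω => sq_nonneg _) (hY n).integrable_sq (ε ^ 2)
  rw [le_div_iff₀ (by positivity), mul_comm]
  have hset : {ω | ε ≤ ‖Y n ω - (0 : Ω → ℝ) ω‖} = {ω | ε ^ 2 ≤ Y n ω ^ 2} := by
    ext ω
    simp only [Set.mem_ofPred_eq, Pi.zero_apply, sub_zero, Real.norm_eq_abs]
    rw [sq_le_sq, abs_of_pos hε]
  rw [hset]
  exact hm.trans hn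

/-- Linear combinations of the normalized counts in uniform permutations are asymptotically
normal. -/
theorem tendstoInDistribution_sum_normalizedOcc {m : ℕ} {r : Fin m → ℕ} (hr : ∀ i, 2 ≤ r i)
    (π : ∀ i, Equiv.Perm (Fin (r i))) (t : Fin m → ℝ) :
    TendstoInDistribution (fun n ω => ∑ i, t i * normalizedOcc (π i) (inducedPerm n ω)) atTop id
      (fun _ => pointMeasure)
      (gaussianReal 0 (t ⬝ᵥ (patternCovMatrix π).mulVec t).toNNReal) := by
  set g : ℝ × ℝ → ℝ := fun z => ∑ i, t i * centeredProj (π i) z with hg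
  have hgc : Continuous g :=
    continuous_finsetSum _ fun i _ => (continuous_centeredProj (π i)).const_mul _
  set X : ℕ → (ℕ → ℝ × ℝ) → ℝ := fun k ω => g (ω k) with hX
  have hmp (k : ℕ) := measurePreserving_eval_infinitePi (fun _ : ℕ => unifSquare) k
  have hmem (k : ℕ) : MemLp (X k) 2 pointMeasure :=
    (memLp_unifSquare hgc 2).comp_measurePreserving (hmp k)
  have hgc2 : Continuous fun z => g z ^ 2 := hgc.pow 2
  have hmean : ∫ z, g z ∂unifSquare = 0 := by
    simp only [hg]
    rw [integral_finsetSum _ fun i _ =>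
      integrable_unifSquare ((continuous_centeredProj (π i)).const_mul _)]
    refine Finset.sum_eq_zero fun i _ => ?_
    rw [integral_const_mul, integral_centeredProj _ (by have := hr i; omega), mul_zero]
  have hX0 : pointMeasure[X 0] = 0 := by
    rw [← hmean, ← (hmp 0).map_eq, integral_map (hmp 0).measurable.aemeasurable
      hgc.aestronglyMeasurable]
  have hvar : Var[X 0; pointMeasure] = t ⬝ᵥ (patternCovMatrix π).mulVec t := by
    rw [variance_of_integral_eq_zero (hmem 0).aemeasurable hX0, sum_mul_patternCovMatrix]
    change _ = ∫ z, g z ^ 2 ∂unifSquare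
    rw [← (hmp 0).map_eq, integral_map (hmp 0).measurable.aemeasurable hgc2.aestronglyMeasurable]
  have hclt := tendstoInDistribution_inv_sqrt_mul_sum_sub (X := X) (P := pointMeasure)
    (Y := (id : ℝ → ℝ)) (P' := gaussianReal 0 Var[X 0; pointMeasure].toNNReal)
    ⟨aemeasurable_id, Measure.map_id⟩ (hmem 0)
    (iIndepFun_infinitePi fun _ => hgc.measurable)
    (fun k => ⟨(hmem k).aemeasurable, (hmem 0).aemeasurable, by
      have h1 (k : ℕ) : pointMeasure.map (X k) = unifSquare.map g := by
        rw [← (hmp k).map_eq, Measure.map_map hgc.measurable (hmp k).measurable]; rfl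
      rw [h1, h1]⟩)
  rw [hX0] at hclt
  simp only [mul_zero, sub_zero, hvar] at hclt
  -- Slutsky: the i.i.d. sum carries the limit, and the combined projection errors vanish in mean
  -- square.
  refine tendstoInDistribution_of_tendstoInMeasure_sub _ _ hclt ?_ fun n =>
    (measurable_comp_inducedPerm n fun σ => ∑ i, t i * normalizedOcc (π i) σ).aemeasurable
  have hdiff : ((fun n ω => ∑ i, t i * normalizedOcc (π i) (inducedPerm n ω)) -
      fun (n : ℕ) ω => (√n)⁻¹ * ∑ k ∈ Finset.range n, X k ω) =
      fun n ω => ∑ i, t i * projError (π i) n ω := by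
    funext n ω
    simp only [Pi.sub_apply, projError, mul_sub, Finset.sum_sub_distrib, hX, hg]
    congr 1
    rw [Finset.sum_comm, Finset.mul_sum]
    refine Finset.sum_congr rfl fun i _ => ?_
    rw [← Finset.mul_sum]
    ring
  rw [hdiff]
  choose C hC using fun i => exists_integral_projError_sq_le (by have := hr i; omega : 0 < r i) (π i)
  refine tendstoInMeasure_of_integral_sq_le (b := fun n : ℕ => (m * ∑ i, t i ^ 2 * C i) / n)
    (fun n => memLp_finsetSum _ fun i _ => (memLp_projError (π i) n).const_mul _)
    (tendsto_const_div_atTop_nhds_zero_nat _) ?_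
  filter_upwards [eventually_gt_atTop 0] with n hn
  have hint (i : Fin m) : Integrable (fun ω => t i ^ 2 * projError (π i) n ω ^ 2) pointMeasure :=
    (memLp_projError (π i) n).integrable_sq.const_mul _
  calc _ ≤ ∫ ω, m * ∑ i, t i ^ 2 * projError (π i) n ω ^ 2 ∂pointMeasure := by
        refine integral_mono_of_nonneg (Eventually.of_forall fun ω => sq_nonneg _)
          ((integrable_finsetSum _ fun i _ => hint i).const_mul _) (Eventually.of_forall fun ω => ?_)
        simpa [mul_pow] using sq_sum_le_card_mul_sum_sq (s := Finset.univ)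
          (f := fun i => t i * projError (π i) n ω)
    _ = m * ∑ i, t i ^ 2 * ∫ ω, projError (π i) n ω ^ 2 ∂pointMeasure := by
        rw [integral_const_mul, integral_finsetSum _ fun i _ => hint i]
        simp only [integral_const_mul]
    _ ≤ m * ∑ i, t i ^ 2 * (C i / n) := by
        gcongr with i
        exact hC i n hn
    _ = _ := by
        rw [mul_div_assoc, Finset.sum_div]
        simp only [mul_div_assoc]

end UniformCLT

/-! ### Inversions as a pattern count, and second moments of pattern counts. -/

section Inversions

lemma invCount_eq_occ {n : ℕ} (σ : Equiv.Perm (Fin n)) :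
    invCount σ = occ (Equiv.swap (0 : Fin 2) 1) σ := by
  classical
  rw [occ_eq_card, invCount]
  refine Finset.card_bij (fun p _ => ![p.1, p.2]) ?_ ?_ ?_
  · intro p hp
    obtain ⟨-, h1, h2⟩ := Finset.mem_filter.1 hp
    refine Finset.mem_filter.2 ⟨Finset.mem_univ _, ?_, ?_⟩
    · rw [Fin.strictMono_iff_lt_succ]; simpa using h1
    · rw [Fin.strictMono_iff_lt_succ]; simpa using h2
  · intro p _ p' _ h
    exact Prod.ext (congrFun h 0) (congrFun h 1)
  · intro g hg
    obtain ⟨-, h1, h2⟩ := Finset.mem_filter.1 hg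
    rw [Fin.strictMono_iff_lt_succ] at h1 h2
    refine ⟨(g 0, g 1), Finset.mem_filter.2 ⟨Finset.mem_univ _, ?_, ?_⟩, ?_⟩
    · simpa using h1
    · simpa using h2
    · ext i; fin_cases i <;> rfl

lemma integral_sq_sum_centeredProj {r : ℕ} (hr : 0 < r) (π : Equiv.Perm (Fin r)) (n : ℕ) :
    ∫ ω, (∑ k ∈ Finset.range n, centeredProj π (ω k)) ^ 2 ∂pointMeasure =
      n * patternCov π π := by
  have hmp (k : ℕ) := measurePreserving_eval_infinitePi (fun _ : ℕ => unifSquare) k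
  have hc := continuous_centeredProj π
  have hc2 : Continuous fun z => centeredProj π z * centeredProj π z := hc.mul hc
  have hmean (k : ℕ) : ∫ ω, centeredProj π (ω k) ∂pointMeasure = 0 := by
    rw [← integral_centeredProj π hr, ← (hmp k).map_eq,
      integral_map (hmp k).measurable.aemeasurable hc.aestronglyMeasurable]
  have hvar (k : ℕ) : Var[fun ω : ℕ → ℝ × ℝ => centeredProj π (ω k); pointMeasure] =
      patternCov π π := by
    rw [variance_of_integral_eq_zero (memLp_centeredProj_comp π k).aemeasurable (hmean k),
      patternCov_eq_integral, ← (hmp k).map_eq,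
      integral_map (hmp k).measurable.aemeasurable hc2.aestronglyMeasurable]
    simp only [sq, Function.eval]
  have hindep : iIndepFun (fun (k : ℕ) (ω : ℕ → ℝ × ℝ) => centeredProj π (ω k)) pointMeasure :=
    iIndepFun_infinitePi (X := fun _ => centeredProj π) fun _ => hc.measurable
  have h := IndepFun.variance_sum (μ := pointMeasure) (s := Finset.range n)
    (X := fun (k : ℕ) (ω : ℕ → ℝ × ℝ) => centeredProj π (ω k))
    (fun k _ => memLp_centeredProj_comp π k) fun i _ j _ hij => hindep.indepFun hij
  simp only [hvar, Finset.sum_const, Finset.card_range, nsmul_eq_mul] at h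
  rw [← h, variance_of_integral_eq_zero
    (memLp_finsetSum' _ fun k _ => memLp_centeredProj_comp π k).aemeasurable]
  · simp
  · simp only [Finset.sum_apply]
    rw [integral_finsetSum _ fun k _ => (memLp_centeredProj_comp π k).integrable (by simp)]
    exact Finset.sum_eq_zero fun k _ => hmean k

/-- The normalized counts in uniform permutations are bounded in mean square. -/
lemma exists_sum_normalizedOcc_sq_le {r : ℕ} (hr : 0 < r) (π : Equiv.Perm (Fin r)) :
    ∃ C : ℝ, ∀ n : ℕ, 0 < n →
      ∑ σ : Equiv.Perm (Fin n), 1 / (n.factorial : ℝ) * normalizedOcc π σ ^ 2 ≤ C := by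
  obtain ⟨C, hC⟩ := exists_integral_projError_sq_le hr π
  -- From a² ≤ 2(a - b)² + 2b² with `b` the normalized i.i.d. sum, whose variance is `patternCov π
  -- π`. The absolute value of `C` allows C/n ≤ |C| whatever its sign.
  refine ⟨2 * |C| + 2 * |patternCov π π|, fun n hn => ?_⟩
  have hn' : (1 : ℝ) ≤ n := by exact_mod_cast hn
  have hU := isUniformPerm_inducedPerm n
  have hsum := integral_comp_eq_sum (P := pointMeasure) hU.measurable
    fun σ => normalizedOcc π σ ^ 2
  simp only [hU.prob_eq, smul_eq_mul] at hsum
  rw [← hsum]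
  have hS : MemLp (fun ω : ℕ → ℝ × ℝ => (√n)⁻¹ * ∑ k ∈ Finset.range n, centeredProj π (ω k)) 2
      pointMeasure :=
    (memLp_finsetSum _ fun k _ => memLp_centeredProj_comp π k).const_mul _
  calc _ ≤ ∫ ω, (2 * projError π n ω ^ 2 +
        2 * ((√n)⁻¹ * ∑ k ∈ Finset.range n, centeredProj π (ω k)) ^ 2) ∂pointMeasure := by
        refine integral_mono_of_nonneg (Eventually.of_forall fun ω => sq_nonneg _)
          (((memLp_projError π n).integrable_sq.const_mul 2).add (hS.integrable_sq.const_mul 2))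
          (Eventually.of_forall fun ω => ?_)
        simp only [projError]
        nlinarith [sq_nonneg (normalizedOcc π (inducedPerm n ω) -
          2 * ((√n)⁻¹ * ∑ k ∈ Finset.range n, centeredProj π (ω k)))]
    _ = 2 * ∫ ω, projError π n ω ^ 2 ∂pointMeasure + 2 * patternCov π π := by
        rw [integral_add ((memLp_projError π n).integrable_sq.const_mul 2)
          (hS.integrable_sq.const_mul 2), integral_const_mul, integral_const_mul]
        simp only [mul_pow, integral_const_mul, integral_sq_sum_centeredProj hr π n]
        rw [inv_pow, Real.sq_sqrt (by positivity)]
        field_simp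
    _ ≤ _ := by
        gcongr
        · refine (hC n hn).trans ((le_abs_self _).trans ?_)
          rw [abs_div, abs_of_pos (by positivity : (0 : ℝ) < n)]
          exact div_le_self (abs_nonneg _) hn'
        · exact le_abs_self _

end Inversions

/-! ### Total variation distance between the Mallows and uniform laws. -/

section Mallows

/-- Adding the terms of index j and n - j produces exp(-l n/2) times 2 cosh(l(n/2 - j)), and cosh x
≤ exp(x²/2). -/
lemma geom_sum_exp_le (l : ℝ) (n : ℕ) :
    ∑ j ∈ Finset.range (n + 1), Real.exp (-l) ^ j ≤
      (n + 1) * Real.exp (-l * n / 2 + l ^ 2 * (n + 1) ^ 2 / 2) := by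
  have hrefl := Finset.sum_range_reflect (fun j => Real.exp (-l) ^ j) (n + 1)
  have h2 : 2 * ∑ j ∈ Finset.range (n + 1), Real.exp (-l) ^ j =
      ∑ j ∈ Finset.range (n + 1), (Real.exp (-l) ^ j + Real.exp (-l) ^ (n + 1 - 1 - j)) := by
    rw [Finset.sum_add_distrib, hrefl, two_mul]
  have hterm : ∀ j ∈ Finset.range (n + 1),
      Real.exp (-l) ^ j + Real.exp (-l) ^ (n + 1 - 1 - j) ≤
        2 * Real.exp (-l * n / 2 + l ^ 2 * (n + 1) ^ 2 / 2) := by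
    intro j hj
    have hj' : j ≤ n := Nat.lt_succ_iff.1 (Finset.mem_range.1 hj)
    have hjR : (j : ℝ) ≤ n := by exact_mod_cast hj'
    have hj0 : (0 : ℝ) ≤ j := by positivity
    have e : Real.exp (-l) ^ j + Real.exp (-l) ^ (n + 1 - 1 - j) =
        2 * (Real.exp (-l * n / 2) * Real.cosh (l * (n / 2 - j))) := by
      rw [Real.cosh_eq, ← Real.exp_nat_mul, ← Real.exp_nat_mul, Nat.add_sub_cancel,
        Nat.cast_sub hj', mul_div_assoc', mul_div_cancel₀ _ two_ne_zero, mul_add, ← Real.exp_add,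
        ← Real.exp_add]
      congr 2 <;> ring
    rw [e, Real.exp_add]
    gcongr
    refine (Real.cosh_le_exp_half_sq _).trans (Real.exp_le_exp.2 ?_)
    have hsq : ((n : ℝ) / 2 - j) ^ 2 ≤ (n + 1) ^ 2 :=
      sq_le_sq.2 (abs_le_abs (by linarith) (by linarith))
    rw [mul_pow]
    linarith [mul_le_mul_of_nonneg_left hsq (sq_nonneg l)]
  have h3 := Finset.sum_le_sum hterm
  rw [← h2, Finset.sum_const, Finset.card_range, nsmul_eq_mul] at h3
  push_cast at h3
  linarith

/-- A Gaussian upper bound for the Mallows normalizing constant. -/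
lemma mallowsZ_le (l : ℝ) (n : ℕ) :
    mallowsZ n (Real.exp (-l)) ≤
      n.factorial * Real.exp (-l * ((n.choose 2 : ℝ) / 2) + l ^ 2 * n ^ 3 / 2) := by
  induction n with
  | zero => simp [mallowsZ]
  | succ n ih =>
    have hpos : 0 ≤ mallowsZ n (Real.exp (-l)) := Finset.prod_nonneg fun k _ =>
      Finset.sum_nonneg fun j _ => by positivity
    calc mallowsZ (n + 1) (Real.exp (-l)) = mallowsZ n (Real.exp (-l)) *
          ∑ j ∈ Finset.range (n + 1), Real.exp (-l) ^ j := by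
          rw [mallowsZ, Finset.prod_Icc_succ_top (by omega)]; rfl
      _ ≤ (n.factorial * Real.exp (-l * ((n.choose 2 : ℝ) / 2) + l ^ 2 * n ^ 3 / 2)) *
          ((n + 1) * Real.exp (-l * n / 2 + l ^ 2 * (n + 1) ^ 2 / 2)) :=
          mul_le_mul ih (geom_sum_exp_le l n) (Finset.sum_nonneg fun j _ => by positivity)
            (by positivity)
      _ = (n + 1).factorial * Real.exp (-l * ((n.choose 2 : ℝ) / 2) + l ^ 2 * n ^ 3 / 2 +
          (-l * n / 2 + l ^ 2 * (n + 1) ^ 2 / 2)) := by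
          rw [Real.exp_add (_ + _) (_ + _), Nat.factorial_succ]
          push_cast
          ring
      _ ≤ _ := by
          refine mul_le_mul_of_nonneg_left (Real.exp_le_exp.2 ?_) (by positivity)
          rw [Nat.choose_succ_succ' n 1, Nat.choose_one_right]
          push_cast
          -- The induction has room to spare: (n+1)³ - n³ exceeds (n+1)² by 2n² + n.
          have : (0 : ℝ) ≤ l ^ 2 * (n ^ 2 + n) := by positivity
          nlinarith

/-- For equal total masses, the positive and negative parts of the difference balance, so a
one-sided bound controls the L¹ distance. Hence only an upper bound on the normalizing constant is
needed. -/
lemma sum_abs_sub_eq {α : Type*} [Fintype α] {u p : α → ℝ} (h : ∑ a, u a = ∑ a, p a) :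
    ∑ a, |u a - p a| = 2 * ∑ a, max (u a - p a) 0 := by
  have (a : α) : |u a - p a| = 2 * max (u a - p a) 0 - (u a - p a) := by
    rcases le_total 0 (u a - p a) with h | h
    · rw [abs_of_nonneg h, max_eq_left h]; ring
    · rw [abs_of_nonpos h, max_eq_right h]; ring
  simp only [this, Finset.sum_sub_distrib, h, sub_self, sub_zero, Finset.mul_sum]

/-- The Mallows distribution is close to uniform when `n ^ (3 / 2) * (-log q)` is small. -/
lemma exists_sum_abs_mallows_sub_le : ∃ C : ℝ, ∀ (n : ℕ) (l : ℝ), 0 < n → 0 ≤ l →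
    ∑ σ : Equiv.Perm (Fin n), Real.exp (-l) ^ invCount σ = mallowsZ n (Real.exp (-l)) →
    ∑ σ : Equiv.Perm (Fin n), |1 / (n.factorial : ℝ) -
        Real.exp (-l) ^ invCount σ / mallowsZ n (Real.exp (-l))| ≤
      C * (l * (n : ℝ) ^ (3 / 2 : ℝ)) + (l * (n : ℝ) ^ (3 / 2 : ℝ)) ^ 2 := by
  obtain ⟨C, hC⟩ := exists_sum_normalizedOcc_sq_le (by norm_num) (Equiv.swap (0 : Fin 2) 1)
  refine ⟨2 * √C, fun n l hn hl hZ => ?_⟩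
  have hf : (0 : ℝ) < n.factorial := by positivity
  have hZpos : 0 < mallowsZ n (Real.exp (-l)) := by
    rw [← hZ]
    exact Finset.sum_pos (fun σ _ => by positivity) Finset.univ_nonempty
  set N := (n : ℝ) ^ (3 / 2 : ℝ) with hN
  have hn' : (0 : ℝ) < n := by exact_mod_cast hn
  have hNpos : 0 < N := Real.rpow_pos_of_pos hn' _
  have hN2 : N ^ 2 = n ^ 3 := by
    rw [hN, ← Real.rpow_natCast, ← Real.rpow_mul hn'.le]
    norm_num
  set W : Equiv.Perm (Fin n) → ℝ := fun σ => normalizedOcc (Equiv.swap (0 : Fin 2) 1) σ with hW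
  have hWinv (σ : Equiv.Perm (Fin n)) : (invCount σ : ℝ) - (n.choose 2 : ℝ) / 2 = N * W σ := by
    simp only [hW, normalizedOcc, ← invCount_eq_occ]
    have : ((2 : ℕ) : ℝ) - 1 / 2 = 3 / 2 := by norm_num
    rw [this, ← hN]
    simp [Nat.factorial]
    field_simp
  have hmean : ∑ σ : Equiv.Perm (Fin n), 1 / (n.factorial : ℝ) = 1 := by
    simp [Fintype.card_perm, hf.ne']
  have hterm (σ : Equiv.Perm (Fin n)) : max (1 / (n.factorial : ℝ) -
      Real.exp (-l) ^ invCount σ / mallowsZ n (Real.exp (-l))) 0 ≤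
      1 / n.factorial * (l * N * |W σ| + (l * N) ^ 2 / 2) := by
    refine max_le ?_ (by positivity)
    -- The bound on Z turns into a pointwise lower bound for the Mallows weight; the means C(n,2)/2
    -- cancel and leave the centered count N W. Then 1 - exp(-x) ≤ x gives a bound linear in |W|.
    have h1 : 1 / (n.factorial : ℝ) * Real.exp (-(l * N * W σ) - (l * N) ^ 2 / 2) ≤
        Real.exp (-l) ^ invCount σ / mallowsZ n (Real.exp (-l)) := by
      rw [le_div_iff₀ hZpos]
      calc _ ≤ 1 / (n.factorial : ℝ) * Real.exp (-(l * N * W σ) - (l * N) ^ 2 / 2) *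
            (n.factorial * Real.exp (-l * ((n.choose 2 : ℝ) / 2) + l ^ 2 * n ^ 3 / 2)) := by
            gcongr
            exact mallowsZ_le l n
        _ = Real.exp (-(l * N * W σ) - (l * N) ^ 2 / 2 +
            (-l * ((n.choose 2 : ℝ) / 2) + l ^ 2 * n ^ 3 / 2)) := by
            rw [Real.exp_add (_ - _) (_ + _), mul_mul_mul_comm, one_div_mul_cancel hf.ne', one_mul]
        _ = _ := by
            rw [← Real.exp_nat_mul, mul_pow, hN2]
            congr 1
            linear_combination l * hWinv σ
    have h2 := Real.add_one_le_exp (-(l * N * W σ) - (l * N) ^ 2 / 2)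
    have h3 : l * N * W σ ≤ l * N * |W σ| := by
      gcongr; exact le_abs_self _
    have h4 : 1 / (n.factorial : ℝ) * (1 - Real.exp (-(l * N * W σ) - (l * N) ^ 2 / 2)) ≤
        1 / n.factorial * (l * N * |W σ| + (l * N) ^ 2 / 2) := by
      gcongr
      linarith
    linarith
  have hCS : ∑ σ : Equiv.Perm (Fin n), 1 / (n.factorial : ℝ) * |W σ| ≤ √C := by
    refine Real.le_sqrt_of_sq_le (le_trans ?_ (hC n hn))
    have h := Finset.sum_sq_le_sum_mul_sum_of_sq_le_mul Finset.univ
      (r := fun σ : Equiv.Perm (Fin n) => 1 / (n.factorial : ℝ) * |W σ|)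
      (f := fun _ => 1 / (n.factorial : ℝ)) (g := fun σ => 1 / (n.factorial : ℝ) * W σ ^ 2)
      (fun _ _ => by positivity) (fun _ _ => by positivity)
      (fun σ _ => by rw [mul_pow, sq_abs]; apply le_of_eq; ring)
    rwa [hmean, one_mul] at h
  rw [sum_abs_sub_eq (by rw [hmean, ← Finset.sum_div, hZ, div_self hZpos.ne'])]
  calc _ ≤ 2 * ∑ σ : Equiv.Perm (Fin n), 1 / (n.factorial : ℝ) *
        (l * N * |W σ| + (l * N) ^ 2 / 2) := by
        gcongr with σ
        exact hterm σ
    _ = 2 * (l * N * ∑ σ : Equiv.Perm (Fin n), 1 / (n.factorial : ℝ) * |W σ| +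
        (∑ σ : Equiv.Perm (Fin n), 1 / (n.factorial : ℝ)) * ((l * N) ^ 2 / 2)) := by
        congr 1
        rw [Finset.mul_sum, Finset.sum_mul, ← Finset.sum_add_distrib]
        refine Finset.sum_congr rfl fun σ _ => ?_
        ring
    _ ≤ 2 * (l * N * √C + 1 * ((l * N) ^ 2 / 2)) := by
        rw [hmean]; gcongr
    _ = _ := by ring

/-- If `n ^ (3 / 2) * (1 - q n)` tends to `0`, the total variation distance between the Mallows and
the uniform distribution vanishes. -/
lemma tendsto_sum_abs_mallows_sub {Ω : ℕ → Type*} [∀ n, MeasurableSpace (Ω n)]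
    (P : ∀ n, Measure (Ω n)) [∀ n, IsProbabilityMeasure (P n)]
    (q : ℕ → ℝ) (hq_pos : ∀ n, 0 < q n) (hq_le : ∀ n, q n ≤ 1)
    (hq : Tendsto (fun n : ℕ => (n : ℝ) ^ (3 / 2 : ℝ) * (1 - q n)) atTop (𝓝 0))
    (τ : ∀ n, Ω n → Equiv.Perm (Fin n)) (hτ : ∀ n, IsMallows (P n) (q n) (τ n)) :
    Tendsto (fun n : ℕ => ∑ σ : Equiv.Perm (Fin n), |1 / (n.factorial : ℝ) -
      (P n).real (τ n ⁻¹' {σ})|) atTop (𝓝 0) := by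
  obtain ⟨C, hC⟩ := exists_sum_abs_mallows_sub_le
  have hlog : Tendsto (fun n : ℕ => -Real.log (q n) * (n : ℝ) ^ (3 / 2 : ℝ)) atTop (𝓝 0) := by
    refine squeeze_zero' (Eventually.of_forall fun n => ?_) ?_ (by simpa using hq.const_mul 2)
    · exact mul_nonneg (neg_nonneg.2 (Real.log_nonpos (hq_pos n).le (hq_le n))) (by positivity)
    · filter_upwards [hq.eventually_lt_const (show (0 : ℝ) < 1 / 2 by norm_num),
        eventually_gt_atTop 0] with n hn h0
      have hn1 : (1 : ℝ) ≤ (n : ℝ) ^ (3 / 2 : ℝ) :=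
        Real.one_le_rpow (by exact_mod_cast h0) (by norm_num)
      -- Eventually q ≥ 1/2, so -log q ≤ 1/q - 1 = (1 - q)/q ≤ 2(1 - q).
      have hhalf : 1 / 2 ≤ q n := by nlinarith [hq_le n]
      have hl : -Real.log (q n) ≤ 2 * (1 - q n) := by
        have h1 := Real.log_le_sub_one_of_pos (inv_pos.2 (hq_pos n))
        rw [Real.log_inv] at h1
        refine h1.trans ?_
        have : (q n)⁻¹ * q n = 1 := inv_mul_cancel₀ (hq_pos n).ne'
        have hi : (q n)⁻¹ ≤ 2 := by
          rw [inv_le_comm₀ (hq_pos n) two_pos]; linarith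
        nlinarith [hq_le n]
      calc _ ≤ 2 * (1 - q n) * (n : ℝ) ^ (3 / 2 : ℝ) := by gcongr
        _ = _ := by ring
  refine squeeze_zero' (Eventually.of_forall fun n => Finset.sum_nonneg fun σ _ => abs_nonneg _) ?_
    (by simpa only [mul_zero, add_zero, ne_eq, OfNat.ofNat_ne_zero, not_false_eq_true, zero_pow]
      using (hlog.const_mul C).add (hlog.pow 2))
  filter_upwards [eventually_gt_atTop 0] with n hn
  have hexp : Real.exp (-(-Real.log (q n))) = q n := by rw [neg_neg, Real.exp_log (hq_pos n)]
  have hZ : mallowsZ n (q n) ≠ 0 := by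
    refine (Finset.prod_pos fun k hk => Finset.sum_pos (fun j _ => pow_pos (hq_pos n) j) ?_).ne'
    have := (Finset.mem_Icc.1 hk).1
    exact ⟨0, Finset.mem_range.2 (by omega)⟩
  have h := hC n (-Real.log (q n)) hn (neg_nonneg.2 (Real.log_nonpos (hq_pos n).le (hq_le n)))
  rw [hexp] at h
  simp only [(hτ n).prob_eq]
  refine h ?_
  -- The generating function identity Σ q^inv = Z need not be proved: it is forced by the
  -- probabilities of `τ n` summing to one.
  have h1 := sum_prob_eq_one (P := P n) (hτ n).measurable
  simp only [(hτ n).prob_eq, ← Finset.sum_div] at h1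
  exact (div_eq_one_iff_eq hZ).1 h1

end Mallows

/-! ### Transfer through characteristic functions, and the theorem. -/

section Main

variable {m : ℕ} {r : Fin m → ℕ}

open Complex in
/-- Convergence of the characteristic functions of the joint counts, written as finite sums. -/
lemma tendsto_sum_exp_inner_occVector (hr : ∀ i, 2 ≤ r i) (π : ∀ i, Equiv.Perm (Fin (r i)))
    (t : EuclideanSpace ℝ (Fin m)) :
    Tendsto (fun n : ℕ => ∑ σ : Equiv.Perm (Fin n), (1 / (n.factorial : ℝ)) •
      exp (inner ℝ (occVector π σ) t * I)) atTop
      (𝓝 (charFun (multivariateGaussian 0 (patternCovMatrix π)) t)) := by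
  have hS := posSemidef_patternCovMatrix π
  have h := tendstoInDistribution_sum_normalizedOcc hr π t
  -- Cramér–Wold: the joint characteristic function at `t` is that of the linear combination with
  -- coefficients `t`, evaluated at 1.
  have h1 := ProbabilityMeasure.tendsto_iff_tendsto_charFun.1 h.tendsto 1
  simp only [ProbabilityMeasure.coe_mk, Measure.map_id, charFun_gaussianReal] at h1
  rw [charFun_multivariateGaussian hS]
  convert! h1 using 2 with n
  · have hU := isUniformPerm_inducedPerm n
    rw [charFun_apply, integral_map (h.forall_aemeasurable n) (by fun_prop)]
    have := integral_comp_eq_sum (P := pointMeasure) hU.measurable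
      fun σ => exp (inner ℝ (∑ i, t i * normalizedOcc (π i) σ) (1 : ℝ) * I)
    rw [this]
    simp only [hU.prob_eq]
    refine Finset.sum_congr rfl fun σ _ => ?_
    congr 4
    simp [occVector, PiLp.inner_apply]
  · have : 0 ≤ t ⬝ᵥ (patternCovMatrix π).mulVec t := by
      simpa using hS.dotProduct_mulVec_nonneg t.ofLp
    rw [Real.coe_toNNReal _ this]
    simp

open Complex in
/-- A sequence of random permutations that is asymptotically uniform in total variation has
asymptotically normal pattern counts. -/
theorem tendstoInDistribution_occVector (hr : ∀ i, 2 ≤ r i) (π : ∀ i, Equiv.Perm (Fin (r i)))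
    {Ω : ℕ → Type*} [∀ n, MeasurableSpace (Ω n)]
    (P : ∀ n, Measure (Ω n)) [∀ n, IsProbabilityMeasure (P n)]
    (τ : ∀ n, Ω n → Equiv.Perm (Fin n)) (hτ : ∀ n σ, MeasurableSet (τ n ⁻¹' {σ}))
    (h : Tendsto (fun n : ℕ => ∑ σ : Equiv.Perm (Fin n), |1 / (n.factorial : ℝ) -
      (P n).real (τ n ⁻¹' {σ})|) atTop (𝓝 0)) :
    TendstoInDistribution (fun n ω => occVector π (τ n ω)) atTop id P
      (multivariateGaussian 0 (patternCovMatrix π)) := by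
  have hm (n : ℕ) : AEMeasurable (fun ω => occVector π (τ n ω)) (P n) :=
    (measurable_comp_of_preimage_singleton (hτ n) _).aemeasurable
  refine ⟨hm, aemeasurable_id, ProbabilityMeasure.tendsto_of_tendsto_charFun fun t => ?_⟩
  simp only [ProbabilityMeasure.coe_mk, Measure.map_id]
  have hU := tendsto_sum_exp_inner_occVector hr π t
  have hchar (n : ℕ) : charFun ((P n).map fun ω => occVector π (τ n ω)) t =
      ∑ σ : Equiv.Perm (Fin n), (P n).real (τ n ⁻¹' {σ}) •
        exp (inner ℝ (occVector π σ) t * I) := by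
    rw [charFun_apply, integral_map (hm n) (by fun_prop)]
    exact integral_comp_eq_sum (hτ n) fun σ => exp (inner ℝ (occVector π σ) t * I)
  simp only [hchar]
  -- Write the characteristic function as the uniform one minus a difference. Each exponential has
  -- modulus one, so the difference is at most the L¹ distance of the laws.
  rw [← sub_zero (charFun _ t)]
  refine (hU.sub (squeeze_zero_norm (fun n => ?_) h)).congr fun n => sub_sub_cancel _ _
  rw [← Finset.sum_sub_distrib]
  refine (norm_sum_le _ _).trans (Finset.sum_le_sum fun σ _ => ?_)
  rw [← sub_smul, norm_smul, Complex.norm_exp_ofReal_mul_I, mul_one, Real.norm_eq_abs]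

end Main

theorem mainTheorem3
    {Ω : ℕ → Type*} [∀ n, MeasurableSpace (Ω n)]
    (P : ∀ n, Measure (Ω n)) [∀ n, IsProbabilityMeasure (P n)]
    {Ω' : ℕ → Type*} [∀ n, MeasurableSpace (Ω' n)]
    (P' : ∀ n, Measure (Ω' n)) [∀ n, IsProbabilityMeasure (P' n)]
    (q : ℕ → ℝ) (hq_pos : ∀ n, 0 < q n) (hq_le : ∀ n, q n ≤ 1)
    (hq : Tendsto (fun n : ℕ => (n : ℝ) ^ (3 / 2 : ℝ) * (1 - q n)) atTop (𝓝 0))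
    (τ : ∀ n, Ω n → Equiv.Perm (Fin n)) (hτ : ∀ n, IsMallows (P n) (q n) (τ n))
    (u : ∀ n, Ω' n → Equiv.Perm (Fin n)) (hu : ∀ n, IsUniformPerm (P' n) (u n))
    {m : ℕ} (r : Fin m → ℕ) (hr : ∀ i, 2 ≤ r i) (π : ∀ i, Equiv.Perm (Fin (r i))) :
    (patternCovMatrix π).PosSemidef ∧
    (∀ i, 0 < patternCov (π i) (π i)) ∧
    -- the single-pattern central limit theorems
    (∀ i, TendstoInDistribution (fun n ω => normalizedOcc (π i) (τ n ω)) atTop id P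
      (gaussianReal 0 (patternCov (π i) (π i)).toNNReal)) ∧
    -- the joint central limit theorem
    TendstoInDistribution (fun n ω => occVector π (τ n ω)) atTop id P
      (multivariateGaussian 0 (patternCovMatrix π)) ∧
    -- the limit is the one obtained for uniform permutations
    TendstoInDistribution (fun n ω => occVector π (u n ω)) atTop id P'
      (multivariateGaussian 0 (patternCovMatrix π)) := by
  have hS := posSemidef_patternCovMatrix π
  have hjoint := tendstoInDistribution_occVector hr π P τ (fun n => (hτ n).measurable)
    (tendsto_sum_abs_mallows_sub P q hq_pos hq_le hq τ hτ)
  refine ⟨hS, fun i => patternCov_self_pos (hr i) (π i), fun i => ?_, hjoint, ?_⟩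
  · have h := hjoint.continuous_comp (g := fun x : EuclideanSpace ℝ (Fin m) => x i) (by fun_prop)
    have hmp := measurePreserving_eval_multivariateGaussian (μ := 0) hS (i := i)
    refine ⟨h.forall_aemeasurable, aemeasurable_id, ?_⟩
    have ht := h.tendsto
    convert! ht using 3
    exact congrArg 𝓝 (Subtype.ext (Measure.map_id.trans hmp.map_eq.symm))
  · refine tendstoInDistribution_occVector hr π P' u (fun n => (hu n).measurable) ?_
    simp [(hu _).prob_eq]
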